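/- **Setting.** Let $\mathsf Z$ be a finite set and $\{Z_t\}_{t\ge 0}$ an irreducible time-homogeneous Markov chain on $\mathsf Z$ with transition probabilities $P$. Let $\{\epsilon_t\}$, $\{\zeta_t\}$, $\{\eta_t\}$ be i.i.d. processes with values in measurable spaces, independent of each other and of $\{Z_t\}$. Put $\beta_0=1$ and $$\beta_t=\beta(Z_t,\epsilon_t),\qquad R_t=R(Z_t,\zeta_t),\qquad Y_t=Y(Z_t,\eta_t)\qquad(t\ge 1),$$ where $\beta,R,Y$ are measurable, nonnegative and real-valued. The utility function $u:[0,\infty)\to\mathbb R\cup\{-\infty\}$ is real-valued and twice differentiable on $(0,\infty)$, with $u'>0$ and $u''<0$ there, $u'(c)\to\infty$ as $c\downarrow 0$, $u'(c)<1$ for all large $c$, and $u(0)\le u(c)$ for $c>0$; put $u'(0):=\infty$. $\mathbb E_z$ is expectation given $Z_0=z$, $\mathbb E_{a,z}$ is expectation given $(a_0,Z_0)=(a,z)$, and $\mathbb E$ is expectation when $Z_0$ has the stationary distribution of $P$. A hat denotes next period's value. Let $\mathsf S_0=(0,\infty)\times\mathsf Z$. A *feasible policy* is a Borel function $c:\mathsf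 S_0\to\mathbb R$ with $0\le c(a,z)\le a$. It generates assets $a_{t+1}=R_{t+1}(a_t-c_t)+Y_{t+1}$ with $c_t=c(a_t,Z_t)$ (and $c_t=0$ if $a_t=0$), and it has lifetime value $V_c(a,z)=\mathbb E_{a,z}\sum_{t\ge 0}\beta_0\cdots\beta_t\,u(c_t)$. A feasible policy $c^*$ is *optimal* if $V_c\le V_{c^*}$ on $\mathsf S_0$ for every feasible policy $c$. Let $\mathscr C$ be the set of continuous $c:\mathsf S_0\to\mathbb R$ that are (weakly) increasing in $a$ and satisfy $0<c(a,z)\le a$ for all $(a,z)$ and $\sup_{(a,z)\in\mathsf S_0}|u'(c(a,z))-u'(a)|<\infty$. Equip $\mathscr C$ with the metric $\rho(c,d)=\sup_{(a,z)\in\mathsf S_0}|u'(c(a,z))-u'(d(a,z))|$. For $c\in\mathscr C$, the time iteration operator $T$ assigns to $(a,z)$ the number $Tc(a,z)=\xi\in(0,a]$ that solves $$u'(\xi)=\max\bigl\{\mathbb E_z\,\hat\beta\hat R\,(u'\circ c)\bigl(\hat R(a-\xi)+\hat Y,\hat Z\bigr),\;u'(a)\bigr\}.$$ **Theorem.** Assume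 that $\mathbb E\,\beta_1<\infty$ and $\mathbb E\,\beta_1R_1<\infty$, that $$G_\beta:=\lim_{n\to\infty}\Bigl(\mathbb E\prod_{t=1}^n\beta_t\Bigr)^{1/n}<1,\qquad G_{\beta R}:=\lim_{n\to\infty}\Bigl(\mathbb E\prod_{t=1}^n\beta_tR_t\Bigr)^{1/n}<1,$$ and that $\mathbb E\,Y_1<\infty$ and $\mathbb E\,u'(Y_1)<\infty$. Then $T$ is well defined (for every $c\in\mathscr C$ and $(a,z)\in\mathsf S_0$ the equation has exactly one solution $\xi\in(0,a]$) and maps $\mathscr C$ into $\mathscr C$, and there is an integer $n\ge 1$ such that $T^n$ is a contraction on $(\mathscr C,\rho)$ with some modulus $\theta<1$. In particular: 1. $T$ has a unique fixed point $c^*\in\mathscr C$. 2. $c^*$ is an optimal policy, and it is the only optimal policy in $\mathscr C$. 3. $\rho(T^kc,c^*)\to 0$ as $k\to\infty$ for every $c\in\mathscr C$. -/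

import Mathlib

open MeasureTheory ProbabilityTheory Filter Topology
open scoped ENNReal NNReal

noncomputable section

/-- Primitives of the income fluctuation problem, with the standing assumptions on them.
`Z` is the finite state space of the exogenous Markov chain; `E`, `F`, `H` are the spaces in which
the innovations to the discount factor, to the gross return on wealth and to non-financial income
take their values. -/
structure IncomeFluctuation (Z E F H : Type*) [Finite Z] [MeasurableSpace Z]
    [DiscreteMeasurableSpace Z] [MeasurableSpace E] [MeasurableSpace F] [MeasurableSpace H] where
  /-- Transition probabilities of the exogenous Markov chain. -/
  P : Z → PMF Z
  /-- Every state can be reached from every state through transitions of positive probability. -/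
  irreducible : ∀ z z' : Z, Relation.ReflTransGen (fun x y => P x y ≠ 0) z z'
  /-- Marginal law of the innovations to the discount factor. -/
  lawE : ProbabilityMeasure E
  /-- Marginal law of the innovations to the return on wealth. -/
  lawF : ProbabilityMeasure F
  /-- Marginal law of the innovations to non-financial income. -/
  lawH : ProbabilityMeasure H
  /-- The discount factor is `β (Z_t, ε_t)`. -/
  β : Z × E → ℝ≥0
  /-- The gross return on wealth is `R (Z_t, ζ_t)`. -/
  R : Z × F → ℝ≥0
  /-- Non-financial income is `Y (Z_t, η_t)`. -/
  Y : Z × H → ℝ≥0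
  measurable_β : Measurable β
  measurable_R : Measurable R
  measurable_Y : Measurable Y
  /-- Utility; only its values on `[0, ∞)` matter. It is real-valued on `(0, ∞)`, and the value at
  `0` may be `-∞`. -/
  u : ℝ → EReal
  u_ne_top : ∀ x, 0 < x → u x ≠ ⊤
  u_ne_bot : ∀ x, 0 < x → u x ≠ ⊥
  u_zero_le : ∀ x, 0 < x → u 0 ≤ u x
  differentiableAt_u : ∀ x, 0 < x → DifferentiableAt ℝ (fun y => (u y).toReal) x
  differentiableAt_deriv_u :
    ∀ x, 0 < x → DifferentiableAt ℝ (deriv fun y => (u y).toReal) x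
  deriv_u_pos : ∀ x, 0 < x → 0 < deriv (fun y => (u y).toReal) x
  deriv_deriv_u_neg : ∀ x, 0 < x → deriv (deriv fun y => (u y).toReal) x < 0
  tendsto_deriv_u : Tendsto (deriv fun y => (u y).toReal) (𝓝[>] 0) atTop
  deriv_u_lt_one : ∀ᶠ x in atTop, deriv (fun y => (u y).toReal) x < 1

namespace IncomeFluctuation

/-- The state space `(0, ∞) × Z` of assets and exogenous states. -/
abbrev State (Z : Type*) := Set.Ioi (0 : ℝ) × Z

/-- Exogenous variables of one period: the chain and the three innovations. -/
abbrev Shock (Z E F H : Type*) := Z × E × F × H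

variable {Z E F H : Type*} [Finite Z] [MeasurableSpace Z] [DiscreteMeasurableSpace Z]
  [MeasurableSpace E] [MeasurableSpace F] [MeasurableSpace H]

section Exogenous

variable (M : IncomeFluctuation Z E F H)

/-- Law of the exogenous variables of one period when the chain has law `ν` in that period: the
three innovations are independent of each other and of the chain. -/
def shockLaw (ν : PMF Z) : Measure (Shock Z E F H) :=
  ν.toMeasure.prod
    ((M.lawE : Measure E).prod ((M.lawF : Measure F).prod (M.lawH : Measure H)))

instance (ν : PMF Z) : IsProbabilityMeasure (M.shockLaw ν) := by
  unfold shockLaw; infer_instance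

/-- Law of next period's exogenous variables given the current state of the chain. -/
def stepKernel : Kernel Z (Shock Z E F H) where
  toFun z := M.shockLaw (M.P z)
  measurable' := Measurable.of_discrete

instance : IsMarkovKernel M.stepKernel :=
  ⟨fun z => inferInstanceAs (IsProbabilityMeasure (M.shockLaw (M.P z)))⟩

/-- Conditional law of the exogenous variables of period `n + 1` given those of the periods
`0, …, n`. -/
def historyKernel (n : ℕ) :
    Kernel ((_ : Finset.Iic n) → Shock Z E F H) (Shock Z E F H) :=
  M.stepKernel.comap (fun x => (x ⟨n, Finset.mem_Iic.2 le_rfl⟩).1) (by fun_prop)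

instance (n : ℕ) : IsMarkovKernel (M.historyKernel n) := by
  unfold historyKernel; infer_instance

/-- Law of the path `(Z_t, ε_t, ζ_t, η_t)_{t ≥ 0}` when `Z_0` has law `ν`: `(Z_t)` is a Markov chain
with transition probabilities `P`, and the innovations are iid over time, independent of each
other and of the chain. -/
def pathLaw (ν : PMF Z) : Measure (ℕ → Shock Z E F H) :=
  Kernel.trajMeasure (X := fun _ => Shock Z E F H) (M.shockLaw ν) M.historyKernel

/-- `π` is a stationary distribution of the chain. -/
def IsStationary (π : PMF Z) : Prop := π.bind M.P = π

/-- The discount factor as a function of the exogenous variables of the period. -/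
def disc (x : Shock Z E F H) : ℝ≥0 := M.β (x.1, x.2.1)

/-- The gross return on wealth as a function of the exogenous variables of the period. -/
def ret (x : Shock Z E F H) : ℝ≥0 := M.R (x.1, x.2.2.1)

/-- Non-financial income as a function of the exogenous variables of the period. -/
def inc (x : Shock Z E F H) : ℝ≥0 := M.Y (x.1, x.2.2.2)

/-- The growth rate `lim_n (𝔼 ∏_{t=1}^n φ_t)^{1/n}` for the chain started from `π`. The limit is
written as an upper limit, which is the limit whenever the latter exists. -/
def growthRate (π : PMF Z) (φ : Shock Z E F H → ℝ≥0) : ℝ≥0∞ :=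
  limsup (fun n : ℕ =>
    (∫⁻ ω, ((∏ t ∈ Finset.Icc 1 n, φ (ω t) : ℝ≥0) : ℝ≥0∞) ∂M.pathLaw π) ^ (1 / (n : ℝ))) atTop

end Exogenous

section Policies

variable (M : IncomeFluctuation Z E F H)

/-- Marginal utility `u'`, meaningful on `(0, ∞)`. -/
def marg (x : ℝ) : ℝ := deriv (fun y => (M.u y).toReal) x

/-- Marginal utility on `[0, ∞)` with `u'(0) = ∞`. -/
def margExt (x : ℝ) : ℝ≥0∞ := if 0 < x then ENNReal.ofReal (M.marg x) else ⊤

/-- A feasible policy is Borel measurable and satisfies `0 ≤ c(a, z) ≤ a`. -/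
def IsFeasible (c : State Z → ℝ) : Prop :=
  Measurable c ∧ ∀ s : State Z, 0 ≤ c s ∧ c s ≤ s.1

/-- Extension of a policy to all asset levels; with zero assets only zero consumption is
feasible. -/
def extendPolicy (c : State Z → ℝ) (a : ℝ) (z : Z) : ℝ :=
  open Classical in if h : 0 < a then c (⟨a, h⟩, z) else 0

/-- Asset path generated by the policy `c` and initial assets `a`. -/
def assets (c : State Z → ℝ) (a : ℝ) (ω : ℕ → Shock Z E F H) : ℕ → ℝ
  | 0 => a
  | t + 1 => M.ret (ω (t + 1)) * (assets c a ω t - extendPolicy c (assets c a ω t) (ω t).1)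
      + M.inc (ω (t + 1))

/-- Consumption in period `t` along the path generated by `c`. -/
def consumption (c : State Z → ℝ) (a : ℝ) (ω : ℕ → Shock Z E F H) (t : ℕ) : ℝ :=
  extendPolicy c (M.assets c a ω t) (ω t).1

/-- The compound discount factor `β_0 β_1 ⋯ β_t`, where `β_0 = 1`. -/
def cumDisc (ω : ℕ → Shock Z E F H) (t : ℕ) : ℝ≥0 := ∏ i ∈ Finset.Icc 1 t, M.disc (ω i)

/-- Lifetime value `V_c(a, z) = 𝔼_{a,z} ∑_t β_0 ⋯ β_t u(c_t)`, with values in `[-∞, ∞]`: expected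
discounted sum of the positive parts of `u(c_t)` minus that of the negative parts. -/
def lifetimeValue (c : State Z → ℝ) (s : State Z) : EReal :=
  ((∫⁻ ω, ∑' t, (M.cumDisc ω t : ℝ≥0∞) * (M.u (M.consumption c s.1 ω t)).toENNReal
      ∂M.pathLaw (PMF.pure s.2) : ℝ≥0∞) : EReal)
  - ((∫⁻ ω, ∑' t, (M.cumDisc ω t : ℝ≥0∞) * (-M.u (M.consumption c s.1 ω t)).toENNReal
      ∂M.pathLaw (PMF.pure s.2) : ℝ≥0∞) : EReal)

/-- A feasible policy whose lifetime value is the highest at every state. -/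
def IsOptimal (c : State Z → ℝ) : Prop :=
  IsFeasible c ∧ ∀ d : State Z → ℝ, IsFeasible d →
    ∀ s : State Z, M.lifetimeValue d s ≤ M.lifetimeValue c s

/-- Membership in the candidate space `𝒞`. Continuity is stated for each `z`, since `Z` is finite
and carries the discrete topology. -/
structure IsCandidate (c : State Z → ℝ) : Prop where
  continuous : ∀ z : Z, Continuous fun a : Set.Ioi (0 : ℝ) => c (a, z)
  monotone : ∀ z : Z, Monotone fun a : Set.Ioi (0 : ℝ) => c (a, z)
  pos : ∀ s : State Z, 0 < c s
  le : ∀ s : State Z, c s ≤ s.1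
  bdd : BddAbove (Set.range fun s : State Z => |M.marg (c s) - M.marg s.1|)

/-- The candidate space `𝒞`. -/
def Candidate : Type _ := {c : State Z → ℝ // M.IsCandidate c}

instance : CoeFun M.Candidate fun _ => State Z → ℝ := ⟨Subtype.val⟩

theorem marg_strictAntiOn : StrictAntiOn M.marg (Set.Ioi 0) :=
  strictAntiOn_of_deriv_neg (convex_Ioi 0)
    (fun x hx => (M.differentiableAt_deriv_u x hx).continuousAt.continuousWithinAt)
    (fun x hx => M.deriv_deriv_u_neg x (by simpa using hx))

theorem bddAbove_marg_sub (c d : M.Candidate) :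
    BddAbove (Set.range fun s : State Z => |M.marg (c s) - M.marg (d s)|) := by
  obtain ⟨A, hA⟩ := c.2.bdd
  obtain ⟨B, hB⟩ := d.2.bdd
  refine ⟨A + B, ?_⟩
  rintro _ ⟨s, rfl⟩
  have h1 : |M.marg (c s) - M.marg s.1| ≤ A := hA ⟨s, rfl⟩
  have h2 : |M.marg (d s) - M.marg s.1| ≤ B := hB ⟨s, rfl⟩
  have h3 := abs_sub_le (M.marg (c s)) (M.marg s.1) (M.marg (d s))
  rw [abs_sub_comm (M.marg s.1)] at h3
  exact h3.trans (add_le_add h1 h2)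

/-- The metric `ρ(c, d) = sup |u'(c(a, z)) - u'(d(a, z))|` on `𝒞`. -/
instance : MetricSpace M.Candidate where
  dist c d := ⨆ s : State Z, |M.marg (c s) - M.marg (d s)|
  dist_self c := by simp
  dist_comm c d := by simp only [abs_sub_comm]
  dist_triangle c d e := by
    refine Real.iSup_le (fun s => ?_) (add_nonneg (Real.iSup_nonneg fun s => abs_nonneg _)
      (Real.iSup_nonneg fun s => abs_nonneg _))
    exact (abs_sub_le _ (M.marg (d s)) _).trans
      (add_le_add (le_ciSup (M.bddAbove_marg_sub c d) s) (le_ciSup (M.bddAbove_marg_sub d e) s))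
  eq_of_dist_eq_zero := by
    intro c d h
    refine Subtype.ext (funext fun s => ?_)
    refine M.marg_strictAntiOn.injOn (c.2.pos s) (d.2.pos s) ?_
    have h1 : |M.marg (c s) - M.marg (d s)| ≤ 0 :=
      (le_ciSup (M.bddAbove_marg_sub c d) s).trans h.le
    exact sub_eq_zero.1 (abs_nonpos_iff.1 h1)

/-- `ψ_c(ξ, a, z) = max {𝔼_z β̂ R̂ u'(c(R̂ (a - ξ) + Ŷ, Ẑ)), u'(a)}`, where hats denote next period's
values. -/
def psi (c : State Z → ℝ) (ξ : ℝ) (s : State Z) : ℝ≥0∞ :=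
  max (∫⁻ x, ((M.disc x * M.ret x : ℝ≥0) : ℝ≥0∞) *
        M.margExt (extendPolicy c (M.ret x * (s.1 - ξ) + M.inc x) x.1) ∂M.stepKernel s.2)
    (ENNReal.ofReal (M.marg s.1))

/-- `ξ ∈ (0, a]` solves `u'(ξ) = ψ_c(ξ, a, z)`. -/
def SolvesEuler (c : State Z → ℝ) (s : State Z) (ξ : ℝ) : Prop :=
  0 < ξ ∧ ξ ≤ s.1 ∧ ENNReal.ofReal (M.marg ξ) = M.psi c ξ s

/-- `T` is the time iteration operator: for every `c ∈ 𝒞` and every `(a, z)`, the value of `T c` at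
`(a, z)` is the one and only `ξ ∈ (0, a]` that solves `u'(ξ) = ψ_c(ξ, a, z)`. -/
def IsTimeIteration (T : M.Candidate → M.Candidate) : Prop :=
  ∀ (c : M.Candidate) (s : State Z) (ξ : ℝ), M.SolvesEuler c s ξ ↔ ξ = T c s

end Policies

end IncomeFluctuation

end

/-! ### Telescoping in the extended nonnegative reals. -/

noncomputable section

/-! Everything rests on the positive operator `L f(z) = 𝔼_z β̂R̂ f(Ẑ)`, which is `op` with weight
`βR`. By the Markov property its powers compute `𝔼 ∏ β_t R_t` (`lintegral_prod_pathLaw`). An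
irreducible chain has a stationary law charging every state, so a growth rate below one makes `∑
Lⁿ1` finite at each state (`tsum_op_ne_top`). The same holds with weight `β`.

Contraction. The left side of the Euler equation decreases strictly in `ξ` and the right side
increases, so the solution is unique; it exists since `u'(0+) = ∞`. If `u' ∘ c ≤ u' ∘ d + v(z)`,
then `u' ∘ Tc ≤ u' ∘ Td + Lv(z)` (`margAt_solution_le`). Keeping `v` a function of the state, rather
than a supremum, lets `n` steps produce `Lⁿ` itself. With `v = ρ(c, d)` this gives `ρ(Tⁿc, Tⁿd) ≤
(max Lⁿ1) ρ(c, d)`, and `max Lⁿ1 → 0`. Since `𝒞` is complete, Banach's theorem applies to an iterate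
of `T`.

Optimality. Let `c` be the fixed point, and run `c` and a challenger `d` on the same shocks. Price
consumption, savings and assets of both at the discounted `u'` along the path of `c`. Concavity
bounds the utility gain of `d` in each period by the priced difference in consumption. The Euler
inequality with complementary slackness says that a priced difference in assets tomorrow is at most
the priced difference in savings today (`lintegral_euler_le`). The sum telescopes, and only the
priced assets of `c` remain; these are summable (`weighted_assets`), which is transversality. Strict
concavity in period zero gives uniqueness (`value_le`, `isOptimal_iff`). Utility may be unbounded in
both directions, so the comparison is written without subtraction in `[0, ∞]`. -/

/-- A telescoping argument with a transversality condition. -/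
theorem ENNReal.tsum_add_le_of_telescope {p n p' n' A S C A' S' C' : ℕ → ℝ≥0∞} {δ : ℝ≥0∞}
    (h0 : p 0 + n' 0 + C' 0 + δ ≤ p' 0 + n 0 + C 0)
    (h1 : ∀ t, p t + n' t + C' t ≤ p' t + n t + C t)
    (hA : ∀ t, C t + S t = A t) (hA' : ∀ t, C' t + S' t = A' t) (hAA : A 0 = A' 0)
    (hE : ∀ t, A (t + 1) + S' t ≤ S t + A' (t + 1)) (hfin : ∀ t, A' t ≠ ⊤)
    (hlim : Tendsto A' atTop (𝓝 0)) :
    ∑' t, p t + ∑' t, n' t + δ ≤ ∑' t, p' t + ∑' t, n t := by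
  have hC'fin : ∀ t, C' t ≠ ⊤ := fun t =>
    ne_top_of_le_ne_top (hfin t) (hA' t ▸ le_self_add)
  have hS'le : ∀ t, S' t ≤ A' t := fun t => hA' t ▸ le_add_self
  have hS'fin : ∀ t, S' t ≠ ⊤ := fun t => ne_top_of_le_ne_top (hfin t) (hS'le t)
  have hSle : ∀ t, S t ≤ A t := fun t => hA t ▸ le_add_self
  have hAfin : ∀ t, A t ≠ ⊤ := fun t => by
    induction t with
    | zero => rw [hAA]; exact hfin 0
    | succ t ih =>
      exact ne_top_of_le_ne_top
        (ENNReal.add_ne_top.2 ⟨ne_top_of_le_ne_top ih (hSle t), hfin (t + 1)⟩)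
        (le_self_add.trans (hE t))
  have hSfin : ∀ t, S t ≠ ⊤ := fun t => ne_top_of_le_ne_top (hAfin t) (hSle t)
  -- Only `A'` is assumed finite, yet all of `A, S, C', S'` inherit finiteness; these are the terms
  -- to be cancelled. The utility terms may be infinite and are never cancelled.
  have key : ∀ T, ∑ t ∈ Finset.range (T + 1), (p t + n' t) + δ + S T
      ≤ ∑ t ∈ Finset.range (T + 1), (p' t + n t) + S' T := fun T => by
    induction T with
    | zero =>
      simp only [zero_add, Finset.sum_range_one]
      rw [← ENNReal.add_le_add_iff_right (hC'fin 0)]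
      calc p 0 + n' 0 + δ + S 0 + C' 0 = (p 0 + n' 0 + C' 0 + δ) + S 0 := by ring
        _ ≤ (p' 0 + n 0 + C 0) + S 0 := by gcongr
        _ = p' 0 + n 0 + (C 0 + S 0) := by ring
        _ = p' 0 + n 0 + (C' 0 + S' 0) := by rw [hA, hA', hAA]
        _ = _ := by ring
    | succ T ih =>
      rw [Finset.sum_range_succ _ (T + 1), Finset.sum_range_succ _ (T + 1)]
      set X := ∑ t ∈ Finset.range (T + 1), (p t + n' t)
      set X' := ∑ t ∈ Finset.range (T + 1), (p' t + n t)
      rw [← ENNReal.add_le_add_iff_right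
        (ENNReal.add_ne_top.2 ⟨ENNReal.add_ne_top.2 ⟨hC'fin (T + 1), hSfin T⟩, hS'fin T⟩)]
      calc X + (p (T + 1) + n' (T + 1)) + δ + S (T + 1) + (C' (T + 1) + S T + S' T)
          = (X + δ + S T) + (p (T + 1) + n' (T + 1) + C' (T + 1)) + S (T + 1) + S' T := by ring
        _ ≤ (X' + S' T) + (p' (T + 1) + n (T + 1) + C (T + 1)) + S (T + 1) + S' T := by
          gcongr ?_ + ?_ + _ + _
          exact h1 (T + 1)
        _ = X' + S' T + (p' (T + 1) + n (T + 1)) + ((C (T + 1) + S (T + 1)) + S' T) := by ring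
        _ ≤ X' + S' T + (p' (T + 1) + n (T + 1)) + (S T + (C' (T + 1) + S' (T + 1))) := by
          rw [hA, hA']
          exact add_le_add le_rfl (hE T)
        _ = _ := by ring
  rw [← ENNReal.tsum_add, ← ENNReal.tsum_add]
  have hlim1 : Tendsto (fun T => ∑ t ∈ Finset.range (T + 1), (p t + n' t) + δ) atTop
      (𝓝 (∑' t, (p t + n' t) + δ)) :=
    ((ENNReal.tendsto_nat_tsum _).comp (tendsto_add_atTop_nat 1)).add tendsto_const_nhds
  have hlim2 : Tendsto (fun T => ∑' t, (p' t + n t) + A' T) atTop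
      (𝓝 (∑' t, (p' t + n t))) := by
    simpa using tendsto_const_nhds.add hlim
  refine le_of_tendsto_of_tendsto' hlim1 hlim2 fun T => ?_
  exact (le_self_add.trans (key T)).trans (add_le_add (ENNReal.sum_le_tsum _) (hS'le T))

namespace IncomeFluctuation

variable {Z E F H : Type*} [Finite Z] [MeasurableSpace Z] [DiscreteMeasurableSpace Z]
  [MeasurableSpace E] [MeasurableSpace F] [MeasurableSpace H]

/-! ### The exogenous chain: Markov property, transition operators and growth rates. -/

section ExogenousProcess

attribute [local fun_prop] Measurable.of_discrete

variable (M : IncomeFluctuation Z E F H)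

@[fun_prop] theorem measurable_disc : Measurable M.disc := by
  have := M.measurable_β
  unfold disc; fun_prop

@[fun_prop] theorem measurable_ret : Measurable M.ret := by
  have := M.measurable_R
  unfold ret; fun_prop

@[fun_prop] theorem measurable_inc : Measurable M.inc := by
  have := M.measurable_Y
  unfold inc; fun_prop

/-- One-step conditional expectations of functions of the path up to time `n` and of the exogenous
variables of period `n + 1`. -/
theorem lintegral_pathLaw_step (ν : PMF Z) (n : ℕ)
    {f : (ℕ → Shock Z E F H) → Shock Z E F H → ℝ≥0∞} (hf : Measurable (Function.uncurry f))
    (hdep : ∀ ω ω', (∀ i ≤ n, ω i = ω' i) → f ω = f ω') :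
    ∫⁻ ω, f ω (ω (n + 1)) ∂M.pathLaw ν
      = ∫⁻ ω, ∫⁻ x, f ω x ∂M.stepKernel (ω n).1 ∂M.pathLaw ν := by
  -- Completes a history up to time `n` to a full path. The entries after `n` are filler, to which
  -- `f` is blind by `hdep`.
  let e : ((_ : Finset.Iic n) → Shock Z E F H) → ℕ → Shock Z E F H := fun y i =>
    if h : i ∈ Finset.Iic n then y ⟨i, h⟩ else y ⟨n, Finset.mem_Iic.2 le_rfl⟩
  have he : Measurable e := by
    refine measurable_pi_lambda _ fun i => ?_
    by_cases h : i ∈ Finset.Iic n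
    · simp only [e, h, dif_pos]; fun_prop
    · simp only [e, h, dif_neg, not_false_iff]; fun_prop
  have hfe : ∀ ω, f ω = f (e (Preorder.frestrictLe n ω)) := fun ω =>
    hdep _ _ fun i hi => by simp [e, hi]
  have key := Kernel.map_frestrictLe_trajMeasure_compProd_eq_map_trajMeasure
    (X := fun _ => Shock Z E F H) (μ₀ := M.shockLaw ν) (κ := M.historyKernel) (a := n)
  have hg : Measurable fun p : ((_ : Finset.Iic n) → Shock Z E F H) × Shock Z E F H =>
      f (e p.1) p.2 := hf.comp (Measurable.prodMk (he.comp measurable_fst) measurable_snd)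
  have h1 := congrArg (fun μ => ∫⁻ p, f (e p.1) p.2 ∂μ) key
  rw [Measure.lintegral_compProd hg, lintegral_map hg (by fun_prop),
    lintegral_map (by exact hg.lintegral_kernel_prod_right') (by fun_prop)] at h1
  simp only [← hfe] at h1
  exact h1.symm

theorem lintegral_pathLaw_zero (ν : PMF Z) {f : Shock Z E F H → ℝ≥0∞} (hf : Measurable f) :
    ∫⁻ ω, f (ω 0) ∂M.pathLaw ν = ∫⁻ x, f x ∂M.shockLaw ν := by
  have key : (M.pathLaw ν).map (Preorder.frestrictLe 0) = (M.shockLaw ν).map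
      (MeasurableEquiv.piUnique fun _ : Finset.Iic 0 => Shock Z E F H).symm := by
    unfold pathLaw Kernel.trajMeasure
    rw [Measure.map_comp _ _ (by fun_prop), Kernel.traj_map_frestrictLe, Kernel.partialTraj_self,
      Measure.id_comp]
  have h1 := congrArg (fun μ => ∫⁻ y, f (y ⟨0, by simp⟩) ∂μ) key
  rw [lintegral_map (by fun_prop) (by fun_prop), lintegral_map (by fun_prop) (by fun_prop)] at h1
  exact h1

theorem lintegral_shockLaw_fst (ν : PMF Z) (g : Z → ℝ≥0∞) :
    ∫⁻ x, g x.1 ∂M.shockLaw ν = ∫⁻ z, g z ∂ν.toMeasure := by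
  unfold shockLaw
  rw [lintegral_prod (fun x => g x.1) (Measurable.of_discrete.comp measurable_fst).aemeasurable]
  simp

/-- Integrating out the innovation to income. -/
theorem lintegral_stepKernel_inc (z : Z) {φ : Shock Z E F H → ℝ≥0∞} (hφ : Measurable φ)
    (hφi : ∀ z e f h h', φ (z, e, f, h) = φ (z, e, f, h')) {g : ℝ≥0 → ℝ≥0∞} (hg : Measurable g) :
    ∫⁻ x, φ x * g (M.inc x) ∂M.stepKernel z
      = ∫⁻ x, φ x * ∫⁻ h, g (M.Y (x.1, h)) ∂(M.lawH : Measure H) ∂M.stepKernel z := by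
  have hY := M.measurable_Y
  have hm : Measurable fun y : Z => ∫⁻ h, g (M.Y (y, h)) ∂(M.lawH : Measure H) :=
    Measurable.of_discrete
  change ∫⁻ x, φ x * g (M.inc x) ∂M.shockLaw (M.P z) = ∫⁻ x, φ x * _ ∂M.shockLaw (M.P z)
  unfold shockLaw
  have h1 : Measurable fun x : Shock Z E F H => φ x * g (M.inc x) := by fun_prop
  have h2 : Measurable fun x : Shock Z E F H =>
    φ x * ∫⁻ h, g (M.Y (x.1, h)) ∂(M.lawH : Measure H) := hφ.mul (hm.comp measurable_fst)
  rw [lintegral_prod _ h1.aemeasurable, lintegral_prod _ h2.aemeasurable]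
  refine lintegral_congr fun y => ?_
  rw [lintegral_prod _ (by fun_prop), lintegral_prod _ (by fun_prop)]
  refine lintegral_congr fun e => ?_
  rw [lintegral_prod _ (by fun_prop), lintegral_prod _ (by fun_prop)]
  refine lintegral_congr fun f => ?_
  obtain ⟨h₀⟩ : Nonempty H := M.lawH.nonempty
  simp only [hφi y e f _ h₀, inc]
  rw [lintegral_const_mul _ (by fun_prop), lintegral_const_mul _ (by fun_prop)]
  simp

/-- The transition operator of the chain with weight `φ`. -/
def op (φ : Shock Z E F H → ℝ≥0) (f : Z → ℝ≥0∞) (z : Z) : ℝ≥0∞ :=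
  ∫⁻ x, (φ x : ℝ≥0∞) * f x.1 ∂M.stepKernel z

variable {M}

theorem op_mono (φ : Shock Z E F H → ℝ≥0) : Monotone (M.op φ) := fun _ _ h _ =>
  lintegral_mono fun _ => by dsimp only; gcongr; exact h _

theorem op_const_mul {φ : Shock Z E F H → ℝ≥0} (hφ : Measurable φ) (k : ℝ≥0∞) (f : Z → ℝ≥0∞) :
    M.op φ (fun z => k * f z) = fun z => k * M.op φ f z := by
  funext z
  unfold op
  rw [← lintegral_const_mul _ (by fun_prop)]
  exact lintegral_congr fun x => by ring

theorem op_iterate_const {φ : Shock Z E F H → ℝ≥0} (hφ : Measurable φ) (k : ℝ≥0∞) (n : ℕ) :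
    (M.op φ)^[n] (fun _ => k) = fun z => k * (M.op φ)^[n] 1 z := by
  induction n with
  | zero => simp
  | succ n ih => rw [Function.iterate_succ_apply', ih, op_const_mul hφ,
      Function.iterate_succ_apply']

theorem op_le_mul {φ : Shock Z E F H → ℝ≥0} (hφ : Measurable φ) {k : ℝ≥0∞} {f : Z → ℝ≥0∞}
    (h : ∀ z, f z ≤ k) (z : Z) : M.op φ f z ≤ k * M.op φ 1 z := by
  have hle : f ≤ fun z => k * (1 : Z → ℝ≥0∞) z := fun z => by simpa using h z
  have := op_mono (M := M) φ hle z
  rwa [op_const_mul hφ] at this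

/-- Conditioning on the periods up to `n` integrates out the last factor and replaces `f` by `op φ
f`, so the induction must let `f` vary. -/
theorem lintegral_prod_pathLaw (ν : PMF Z) {φ : Shock Z E F H → ℝ≥0} (hφ : Measurable φ)
    (n : ℕ) (f : Z → ℝ≥0∞) :
    ∫⁻ ω, ((∏ t ∈ Finset.Icc 1 n, φ (ω t) : ℝ≥0) : ℝ≥0∞) * f (ω n).1 ∂M.pathLaw ν
      = ∫⁻ z, (M.op φ)^[n] f z ∂ν.toMeasure := by
  induction n generalizing f with
  | zero =>
    simp only [Finset.Icc_eq_empty_of_lt zero_lt_one, Finset.prod_empty, ENNReal.coe_one, one_mul]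
    rw [M.lintegral_pathLaw_zero ν (f := fun x => f x.1) (by fun_prop), lintegral_shockLaw_fst]
    rfl
  | succ n ih =>
    rw [Function.iterate_succ_apply, ← ih]
    have := M.lintegral_pathLaw_step ν n
      (f := fun ω x => ((∏ t ∈ Finset.Icc 1 n, φ (ω t) : ℝ≥0) : ℝ≥0∞) * (φ x * f x.1))
      (by unfold Function.uncurry; fun_prop)
      (fun ω ω' h => by
        funext x
        rw [Finset.prod_congr rfl fun i hi => by rw [h i (Finset.mem_Icc.1 hi).2]])
    simp only [Finset.prod_Icc_succ_top (Nat.le_add_left 1 n), ENNReal.coe_mul, mul_assoc]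
    rw [this]
    refine lintegral_congr fun ω => ?_
    rw [lintegral_const_mul _ (by fun_prop)]
    rfl

theorem lintegral_toMeasure_pure (z : Z) (f : Z → ℝ≥0∞) :
    ∫⁻ x, f x ∂(PMF.pure z).toMeasure = f z := by
  rw [PMF.toMeasure_pure, lintegral_dirac]

theorem lintegral_stepKernel_fst (z : Z) (g : Z → ℝ≥0∞) :
    ∫⁻ x, g x.1 ∂M.stepKernel z = ∫⁻ z', g z' ∂(M.P z).toMeasure :=
  M.lintegral_shockLaw_fst (M.P z) g

theorem mul_le_lintegral_toMeasure (ν : PMF Z) (f : Z → ℝ≥0∞) (z : Z) :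
    ν z * f z ≤ ∫⁻ x, f x ∂ν.toMeasure := by
  calc ν z * f z = ∫⁻ x in {z}, f x ∂ν.toMeasure := by
        rw [lintegral_singleton, PMF.toMeasure_apply_singleton _ _ (MeasurableSet.of_discrete),
          mul_comm]
    _ ≤ _ := setLIntegral_le_lintegral _ _

/-- Stationarity makes the support of `π` closed under transitions, and irreducibility then makes it
everything. This is what turns moments under `π` into bounds at each state. -/
theorem IsStationary.ne_zero {π : PMF Z} (hπ : M.IsStationary π) (z : Z) : π z ≠ 0 := by
  obtain ⟨z₀, h₀⟩ := π.support_nonempty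
  induction M.irreducible z₀ z with
  | refl => exact h₀
  | @tail y w _ h ih =>
    have h2 : w ∈ (π.bind M.P).support := (PMF.mem_support_bind_iff _ _ _).2 ⟨y, ih, h⟩
    rw [hπ] at h2
    exact h2

theorem IsStationary.exists_pred {π : PMF Z} (hπ : M.IsStationary π) (z : Z) :
    ∃ y, M.P y z ≠ 0 := by
  have h2 : z ∈ π.support := hπ.ne_zero z
  rw [← show π.bind M.P = π from hπ] at h2
  obtain ⟨y, -, hy⟩ := (PMF.mem_support_bind_iff _ _ _).1 h2
  exact ⟨y, hy⟩

theorem ne_top_of_lintegral_toMeasure {ν : PMF Z} {f : Z → ℝ≥0∞} {z : Z} (hz : ν z ≠ 0)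
    (h : ∫⁻ x, f x ∂ν.toMeasure ≠ ⊤) : f z ≠ ⊤ := fun hf => by
  have h1 := mul_le_lintegral_toMeasure ν f z
  rw [hf, ENNReal.mul_top hz, top_le_iff] at h1
  exact h h1

theorem lintegral_pathLaw_one (ν : PMF Z) {f : Shock Z E F H → ℝ≥0∞} (hf : Measurable f) :
    ∫⁻ ω, f (ω 1) ∂M.pathLaw ν = ∫⁻ z, ∫⁻ x, f x ∂M.stepKernel z ∂ν.toMeasure := by
  have hm : Measurable fun x : Shock Z E F H => ∫⁻ y, f y ∂M.stepKernel x.1 := by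
    have h : Measurable fun z => ∫⁻ y, f y ∂M.stepKernel z := Measurable.of_discrete
    exact h.comp measurable_fst
  rw [M.lintegral_pathLaw_step ν 0 (f := fun _ => f) (by unfold Function.uncurry; fun_prop)
    (fun _ _ _ => rfl), M.lintegral_pathLaw_zero ν hm,
    M.lintegral_shockLaw_fst ν (fun z => ∫⁻ y, f y ∂M.stepKernel z)]

/-- Integrability of a function of income under the stationary law makes its conditional
expectations bounded. -/
theorem IsStationary.exists_bound_inc {π : PMF Z} (hπ : M.IsStationary π) {g : ℝ≥0 → ℝ≥0∞}
    (hg : Measurable g) (h : ∫⁻ ω, g (M.inc (ω 1)) ∂M.pathLaw π < ⊤) :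
    ∃ C : ℝ≥0∞, C ≠ ⊤ ∧ ∀ z, ∫⁻ h, g (M.Y (z, h)) ∂(M.lawH : Measure H) ≤ C := by
  have hY := M.measurable_Y
  set k : Z → ℝ≥0∞ := fun z => ∫⁻ h, g (M.Y (z, h)) ∂(M.lawH : Measure H) with hk
  have hfin : ∀ z, k z ≠ ⊤ := fun z => by
    rw [lintegral_pathLaw_one π (f := fun x => g (M.inc x)) (by fun_prop)] at h
    obtain ⟨y, hy⟩ := hπ.exists_pred z
    have h1 := ne_top_of_lintegral_toMeasure (hπ.ne_zero y) h.ne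
    have h2 := M.lintegral_stepKernel_inc y (φ := fun _ => 1) (by fun_prop) (by simp) hg
    simp only [one_mul] at h2
    rw [h2] at h1
    rw [lintegral_stepKernel_fst y k] at h1
    exact ne_top_of_lintegral_toMeasure hy h1
  refine ⟨⨆ z, k z, ?_, fun z => le_iSup k z⟩
  have : Nonempty Z := ⟨π.support_nonempty.some⟩
  obtain ⟨z, hz⟩ := exists_eq_ciSup_of_finite (f := k)
  rw [← hz]; exact hfin z

/-- If `φ` has a growth rate below one, then `∑ₙ φ₁ ⋯ φₙ` has finite conditional expectations. -/
theorem IsStationary.tsum_op_ne_top {π : PMF Z} (hπ : M.IsStationary π)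
    {φ : Shock Z E F H → ℝ≥0} (hφ : Measurable φ)
    (h1 : ∫⁻ ω, (φ (ω 1) : ℝ≥0∞) ∂M.pathLaw π < ⊤) (hG : M.growthRate π φ < 1) (z : Z) :
    ∑' n, (M.op φ)^[n] 1 z ≠ ⊤ := by
  have hne : Nonempty Z := ⟨z⟩
  have hop : ∀ y, M.op φ 1 y ≠ ⊤ := fun y => by
    rw [lintegral_pathLaw_one π (f := fun x => (φ x : ℝ≥0∞)) (by fun_prop)] at h1
    have := ne_top_of_lintegral_toMeasure (hπ.ne_zero y) h1.ne
    simpa [op] using this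
  have hfin : ∀ n y, (M.op φ)^[n] 1 y ≠ ⊤ := fun n => by
    induction n with
    | zero => simp
    | succ n ih =>
      intro y
      obtain ⟨y₀, hy₀⟩ := exists_eq_ciSup_of_finite (f := (M.op φ)^[n] 1)
      rw [Function.iterate_succ_apply']
      refine ne_top_of_le_ne_top (ENNReal.mul_ne_top (ih y₀) (hop y)) (op_le_mul hφ (fun x => ?_) y)
      rw [hy₀]; exact le_iSup ((M.op φ)^[n] 1) x
  obtain ⟨θ, hθ, hθ1⟩ := exists_between hG
  have hev := eventually_lt_of_limsup_lt hθ
  obtain ⟨N, hN⟩ := eventually_atTop.1 hev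
  -- Dividing by the mass `π z` turns the stationary mean into a bound at `z`. Shifting by `N + 1`
  -- instead of `N` keeps the index of the root nonzero.
  have hb : ∀ n, (M.op φ)^[n + (N + 1)] 1 z ≤ (π z)⁻¹ * θ ^ n := fun n => by
    have h2 := (hN (n + (N + 1)) (by omega)).le
    rw [one_div, ENNReal.rpow_inv_le_iff (by positivity), ENNReal.rpow_natCast] at h2
    have h3 := lintegral_prod_pathLaw (M := M) π hφ (n + (N + 1)) 1
    simp only [Pi.one_apply, mul_one] at h3
    rw [h3] at h2
    have h4 := (mul_le_lintegral_toMeasure π _ z).trans h2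
    rw [mul_comm, ← ENNReal.le_div_iff_mul_le (Or.inl (hπ.ne_zero z))
      (Or.inl (PMF.apply_ne_top π z)), ENNReal.div_eq_inv_mul] at h4
    refine h4.trans ?_
    refine mul_le_mul_right ?_ _
    exact pow_le_pow_right_of_le_one' hθ1.le (Nat.le_add_right n (N + 1))
  rw [← ENNReal.summable.sum_add_tsum_nat_add' (k := N + 1)]
  refine ENNReal.add_ne_top.2 ⟨ENNReal.sum_ne_top.2 fun n _ => hfin n z, ?_⟩
  refine ne_top_of_le_ne_top ?_ (ENNReal.tsum_le_tsum hb)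
  rw [ENNReal.tsum_mul_left, ENNReal.tsum_geometric]
  refine ENNReal.mul_ne_top (ENNReal.inv_ne_top.2 (hπ.ne_zero z)) (ENNReal.inv_ne_top.2 ?_)
  exact (tsub_pos_of_lt hθ1).ne'

/-- The resolvent of a transition operator. -/
theorem exists_resolvent {φ : Shock Z E F H → ℝ≥0} (hφ : Measurable φ)
    (h : ∀ z, ∑' n, (M.op φ)^[n] 1 z ≠ ⊤) :
    ∃ w : Z → ℝ≥0∞, (∀ z, w z ≠ ⊤) ∧ ∀ z, w z = 1 + M.op φ w z := by
  refine ⟨fun z => ∑' n, (M.op φ)^[n] 1 z, h, fun z => ?_⟩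
  dsimp only
  rw [tsum_eq_zero_add' ENNReal.summable]
  congr 1
  unfold op
  simp_rw [← ENNReal.tsum_mul_left]
  rw [lintegral_tsum fun n => by fun_prop]
  exact tsum_congr fun n => by rw [Function.iterate_succ_apply']

end ExogenousProcess

/-! ### The Euler equation: existence, uniqueness and regularity of its solution. -/

section TimeIteration

variable (M : IncomeFluctuation Z E F H)

attribute [local fun_prop] Measurable.of_discrete

theorem marg_pos {x : ℝ} (hx : 0 < x) : 0 < M.marg x := M.deriv_u_pos x hx

theorem continuousOn_marg : ContinuousOn M.marg (Set.Ioi 0) := fun x hx =>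
  (M.differentiableAt_deriv_u x hx).continuousAt.continuousWithinAt

theorem margExt_of_pos {x : ℝ} (hx : 0 < x) : M.margExt x = ENNReal.ofReal (M.marg x) :=
  if_pos hx

theorem margExt_of_nonpos {x : ℝ} (hx : x ≤ 0) : M.margExt x = ⊤ := if_neg hx.not_gt

theorem antitone_margExt : Antitone M.margExt := fun x y hxy => by
  rcases le_or_gt x 0 with hx | hx
  · simp [M.margExt_of_nonpos hx]
  · rw [M.margExt_of_pos hx, M.margExt_of_pos (hx.trans_le hxy)]
    exact ENNReal.ofReal_le_ofReal
      (M.marg_strictAntiOn.antitoneOn (Set.mem_Ioi.2 hx) (Set.mem_Ioi.2 (hx.trans_le hxy)) hxy)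

@[fun_prop] theorem measurable_margExt : Measurable M.margExt := M.antitone_margExt.measurable

theorem margExt_lt_top_iff {x : ℝ} : M.margExt x < ⊤ ↔ 0 < x := by
  rcases le_or_gt x 0 with hx | hx
  · simp [M.margExt_of_nonpos hx, hx.not_gt]
  · simp [M.margExt_of_pos hx, hx]

theorem extendPolicy_of_pos {Z : Type*} (c : State Z → ℝ) {a : ℝ} (ha : 0 < a) (z : Z) :
    extendPolicy c a z = c (⟨a, ha⟩, z) := dif_pos ha

theorem extendPolicy_of_nonpos {Z : Type*} (c : State Z → ℝ) {a : ℝ} (ha : a ≤ 0) (z : Z) :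
    extendPolicy c a z = 0 := dif_neg ha.not_gt

theorem measurable_extendPolicy {Z : Type*} [MeasurableSpace Z] {c : State Z → ℝ}
    (hc : Measurable c) :
    Measurable fun p : ℝ × Z => extendPolicy c p.1 p.2 := by
  classical
  have hs : MeasurableSet {p : ℝ × Z | 0 < p.1} := measurableSet_lt measurable_const measurable_fst
  unfold extendPolicy
  refine Measurable.dite (s := {p : ℝ × Z | 0 < p.1})
    (f := fun p => c (⟨p.1.1, p.2⟩, p.1.2)) (g := fun _ => 0) ?_ measurable_const hs
  exact hc.comp (Measurable.prodMk (Measurable.subtype_mk (by fun_prop)) (by fun_prop))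

variable {M}

theorem IsCandidate.measurable {c : State Z → ℝ} (hc : M.IsCandidate c) : Measurable c :=
  measurable_from_prod_countable_left fun z => (hc.continuous z).measurable

theorem IsCandidate.isFeasible {c : State Z → ℝ} (hc : M.IsCandidate c) : IsFeasible c :=
  ⟨hc.measurable, fun s => ⟨(hc.pos s).le, hc.le s⟩⟩

variable (M) in
/-- Marginal utility of consumption under the policy `c`, extended by `∞` to zero assets. -/
def margAt (c : State Z → ℝ) (a : ℝ) (z : Z) : ℝ≥0∞ := M.margExt (extendPolicy c a z)

theorem measurable_margAt {c : State Z → ℝ} (hc : Measurable c) :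
    Measurable fun p : ℝ × Z => M.margAt c p.1 p.2 :=
  M.measurable_margExt.comp (measurable_extendPolicy hc)

theorem IsCandidate.margAt_of_pos {c : State Z → ℝ} (hc : M.IsCandidate c) {a : ℝ} (ha : 0 < a)
    (z : Z) : M.margAt c a z = ENNReal.ofReal (M.marg (c (⟨a, ha⟩, z))) := by
  rw [margAt, extendPolicy_of_pos c ha, M.margExt_of_pos (hc.pos _)]

theorem margAt_of_nonpos (c : State Z → ℝ) {a : ℝ} (ha : a ≤ 0) (z : Z) : M.margAt c a z = ⊤ := by
  rw [margAt, extendPolicy_of_nonpos c ha, M.margExt_of_nonpos le_rfl]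

theorem IsCandidate.antitone_margAt {c : State Z → ℝ} (hc : M.IsCandidate c) (z : Z) :
    Antitone fun a => M.margAt c a z := fun a b hab => by
  rcases le_or_gt a 0 with ha | ha
  · simp [margAt_of_nonpos c ha]
  · refine M.antitone_margExt ?_
    rw [extendPolicy_of_pos c ha, extendPolicy_of_pos c (ha.trans_le hab)]
    exact hc.monotone z (Subtype.mk_le_mk.2 hab)

theorem IsCandidate.continuousAt_margAt {c : State Z → ℝ} (hc : M.IsCandidate c) {a : ℝ}
    (ha : 0 < a) (z : Z) : ContinuousAt (fun a => M.margAt c a z) a := by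
  have h1 : Continuous fun b : Set.Ioi (0 : ℝ) => M.marg (c (b, z)) :=
    M.continuousOn_marg.comp_continuous (hc.continuous z) fun b => hc.pos _
  have h2 : Continuous fun b : Set.Ioi (0 : ℝ) => M.margAt c b z := by
    refine (ENNReal.continuous_ofReal.comp h1).congr fun b => ?_
    rw [hc.margAt_of_pos b.2]; rfl
  exact (continuousOn_iff_continuous_domRestrict.2 h2).continuousAt (Ioi_mem_nhds ha)

/-- With `a` replaced by next period's assets, which are at least income, this dominates marginal
utility by `u'(Ŷ) + K`, whose integrability does not depend on the policy. -/
theorem IsCandidate.exists_margAt_le {c : State Z → ℝ} (hc : M.IsCandidate c) :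
    ∃ K : ℝ≥0, ∀ a z, M.margAt c a z ≤ M.margExt a + K := by
  obtain ⟨K, hK⟩ := hc.bdd
  refine ⟨K.toNNReal, fun a z => ?_⟩
  rcases le_or_gt a 0 with ha | ha
  · simp [M.margExt_of_nonpos ha]
  · have h1 : |M.marg (c (⟨a, ha⟩, z)) - M.marg a| ≤ K := hK ⟨(⟨a, ha⟩, z), rfl⟩
    rw [hc.margAt_of_pos ha, M.margExt_of_pos ha]
    have h2 : M.marg (c (⟨a, ha⟩, z)) ≤ M.marg a + K := by linarith [le_of_abs_le h1]
    refine (ENNReal.ofReal_le_ofReal h2).trans ?_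
    exact ENNReal.ofReal_add_le

variable (M) in
/-- Discounted expected marginal value of savings `s` when next period's policy is `c`. -/
def expMarg (c : State Z → ℝ) (z : Z) (s : ℝ) : ℝ≥0∞ :=
  ∫⁻ x, ((M.disc x * M.ret x : ℝ≥0) : ℝ≥0∞) * M.margAt c (M.ret x * s + M.inc x) x.1
    ∂M.stepKernel z

theorem IsCandidate.antitone_expMarg {c : State Z → ℝ} (hc : M.IsCandidate c) (z : Z) :
    Antitone (M.expMarg c z) := fun s t hst => by
  refine lintegral_mono fun x => ?_
  dsimp only
  gcongr
  exact hc.antitone_margAt _ (by gcongr)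

variable (M) in
/-- Integrability of `βR` and of marginal utility of income, uniformly over the states. -/
structure BoundedMarg (C : ℝ≥0∞) : Prop where
  ne_top : C ≠ ⊤
  op_ne_top : ∀ z, M.op (fun x => M.disc x * M.ret x) 1 z ≠ ⊤
  inc_le : ∀ z, ∫⁻ h, M.margExt (M.Y (z, h)) ∂(M.lawH : Measure H) ≤ C

theorem BoundedMarg.lintegral_le {C : ℝ≥0∞} (hC : M.BoundedMarg C) (K : ℝ≥0) (z : Z) :
    ∫⁻ x, ((M.disc x * M.ret x : ℝ≥0) : ℝ≥0∞) * (M.margExt (M.inc x) + K) ∂M.stepKernel z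
      ≤ (C + K) * M.op (fun x => M.disc x * M.ret x) 1 z := by
  rw [M.lintegral_stepKernel_inc z (φ := fun x => ((M.disc x * M.ret x : ℝ≥0) : ℝ≥0∞))
    (by fun_prop) (fun _ _ _ _ _ => rfl) (g := fun y => M.margExt y + K) (by fun_prop)]
  refine op_le_mul (φ := fun x => M.disc x * M.ret x) (by fun_prop)
    (f := fun z => ∫⁻ h, (M.margExt (M.Y (z, h)) + K) ∂(M.lawH : Measure H)) (fun z => ?_) z
  rw [lintegral_add_right _ measurable_const]
  simpa using hC.inc_le z

theorem BoundedMarg.lintegral_ne_top {C : ℝ≥0∞} (hC : M.BoundedMarg C) (K : ℝ≥0) (z : Z) :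
    ∫⁻ x, ((M.disc x * M.ret x : ℝ≥0) : ℝ≥0∞) * (M.margExt (M.inc x) + K) ∂M.stepKernel z ≠ ⊤ :=
  ne_top_of_le_ne_top (ENNReal.mul_ne_top (ENNReal.add_ne_top.2 ⟨hC.ne_top, ENNReal.coe_ne_top⟩)
    (hC.op_ne_top z)) (hC.lintegral_le K z)

theorem IsCandidate.exists_expMarg_le {C : ℝ≥0∞} (hC : M.BoundedMarg C) {c : State Z → ℝ}
    (hc : M.IsCandidate c) : ∃ B : ℝ≥0, ∀ z s, 0 ≤ s → M.expMarg c z s ≤ B := by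
  obtain ⟨K, hK⟩ := hc.exists_margAt_le
  rcases isEmpty_or_nonempty Z with hZ | hZ
  · exact ⟨0, fun z => hZ.elim z⟩
  set f := fun z => ∫⁻ x, ((M.disc x * M.ret x : ℝ≥0) : ℝ≥0∞) * (M.margExt (M.inc x) + K)
    ∂M.stepKernel z with hf
  obtain ⟨y, hy⟩ := exists_eq_ciSup_of_finite (f := f)
  lift f y to ℝ≥0 using hC.lintegral_ne_top K y with B hB
  refine ⟨B, fun z s hs => ?_⟩
  rw [hy]
  refine le_trans ?_ (le_iSup f z)
  refine lintegral_mono fun x => ?_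
  dsimp only
  gcongr
  refine (hK _ _).trans ?_
  gcongr
  exact M.antitone_margExt (by simpa using mul_nonneg (M.ret x).2 hs)

theorem IsCandidate.continuousOn_expMarg {C : ℝ≥0∞} (hC : M.BoundedMarg C) {c : State Z → ℝ}
    (hc : M.IsCandidate c) (z : Z) : ContinuousOn (M.expMarg c z) (Set.Ici 0) := by
  obtain ⟨K, hK⟩ := hc.exists_margAt_le
  intro s hs
  have hm : ∀ t : ℝ, Measurable fun x : Shock Z E F H =>
      M.margAt c (M.ret x * t + M.inc x) x.1 := fun t =>
    (measurable_margAt hc.measurable).comp (Measurable.prodMk (by fun_prop) measurable_fst)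
  refine tendsto_lintegral_filter_of_dominated_convergence
    (fun x => ((M.disc x * M.ret x : ℝ≥0) : ℝ≥0∞) * (M.margExt (M.inc x) + K))
    (Eventually.of_forall fun t => ?_) ?_ (hC.lintegral_ne_top K z) ?_
  · have := hm t
    fun_prop
  · filter_upwards [self_mem_nhdsWithin] with t ht
    refine Eventually.of_forall fun x => ?_
    gcongr
    refine (hK _ _).trans ?_
    gcongr
    exact M.antitone_margExt (by simpa using mul_nonneg (M.ret x).2 ht)
  -- Continuity can fail only at zero assets, where `u'` is infinite. The dominating function is
  -- almost everywhere finite, so `βR = 0` wherever income vanishes, and such points carry no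
  -- weight.
  · filter_upwards [ae_lt_top (by fun_prop) (hC.lintegral_ne_top K z)] with x hx
    rcases eq_or_ne (M.disc x * M.ret x) 0 with h0 | h0
    · simp only [h0, ENNReal.coe_zero, zero_mul]
      exact tendsto_const_nhds
    · refine ENNReal.Tendsto.const_mul ?_ (Or.inr ENNReal.coe_ne_top)
      have hpos : (0 : ℝ) < M.inc x := by
        rw [← M.margExt_lt_top_iff]
        by_contra hcon
        rw [not_lt, top_le_iff] at hcon
        rw [hcon, top_add, ENNReal.mul_top (by exact_mod_cast h0)] at hx
        exact lt_irrefl _ hx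
      have h1 : ContinuousAt (fun t : ℝ => M.margAt c (M.ret x * t + M.inc x) x.1) s :=
        ContinuousAt.comp (g := fun a => M.margAt c a x.1)
          (hc.continuousAt_margAt (add_pos_of_nonneg_of_pos (mul_nonneg (M.ret x).2 hs) hpos) _)
          (by fun_prop)
      exact h1.mono_left nhdsWithin_le_nhds

/-- Higher consumption lowers `u'(ξ)` strictly but leaves less savings, which can only raise `ψ_c`.
-/
theorem SolvesEuler.le_of_le {c : State Z → ℝ} (hc : M.IsCandidate c) {s : State Z} {ξ ξ' : ℝ}
    (h : M.SolvesEuler c s ξ) (h' : M.SolvesEuler c s ξ') : ξ' ≤ ξ := by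
  by_contra! hlt
  have h1 := M.marg_strictAntiOn (Set.mem_Ioi.2 h.1) (Set.mem_Ioi.2 h'.1) hlt
  have h2 : M.psi c ξ s ≤ M.psi c ξ' s :=
    max_le_max (hc.antitone_expMarg _ (by linarith)) le_rfl
  rw [← h.2.2, ← h'.2.2, ENNReal.ofReal_le_ofReal_iff (M.marg_pos h'.1).le] at h2
  linarith

theorem SolvesEuler.unique {c : State Z → ℝ} (hc : M.IsCandidate c) {s : State Z} {ξ ξ' : ℝ}
    (h : M.SolvesEuler c s ξ) (h' : M.SolvesEuler c s ξ') : ξ = ξ' :=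
  le_antisymm (h'.le_of_le hc h) (h.le_of_le hc h')

theorem IsCandidate.exists_solvesEuler {C : ℝ≥0∞} (hC : M.BoundedMarg C) {c : State Z → ℝ}
    (hc : M.IsCandidate c) (s : State Z) : ∃ ξ, M.SolvesEuler c s ξ := by
  obtain ⟨B, hB⟩ := hc.exists_expMarg_le hC
  obtain ⟨⟨a, ha⟩, z⟩ := s
  have ha : 0 < a := ha
  have hfin : ∀ ξ ≤ a, M.psi c ξ (⟨a, ha⟩, z) ≠ ⊤ := fun ξ hξ =>
    (max_lt ((hB z (a - ξ) (by linarith)).trans_lt ENNReal.coe_lt_top)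
      ENNReal.ofReal_lt_top).ne
  have hcont : ContinuousOn (fun ξ => M.psi c ξ (⟨a, ha⟩, z)) (Set.Iic a) := by
    refine ContinuousOn.sup ?_ continuousOn_const
    exact (hc.continuousOn_expMarg hC z).comp (f := fun ξ => a - ξ) (by fun_prop)
      fun ξ hξ => by simpa using hξ
  have hreal : ContinuousOn (fun ξ => M.marg ξ - (M.psi c ξ (⟨a, ha⟩, z)).toReal) (Set.Ioc 0 a) :=
    (M.continuousOn_marg.mono fun ξ h => h.1).sub
      (ENNReal.continuousOn_toReal.comp (hcont.mono fun ξ h => h.2) fun ξ h => hfin ξ h.2)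
  -- `B + u'(a)` exceeds both terms of the maximum, so at `ξ₀` the left side dominates; at `ξ = a`
  -- the right side does. The intermediate value theorem applies between them.
  obtain ⟨ξ₀, h₀, h₀0, h₀a⟩ : ∃ ξ₀, B + M.marg a ≤ M.marg ξ₀ ∧ 0 < ξ₀ ∧ ξ₀ < a :=
    ((M.tendsto_deriv_u.eventually_ge_atTop (B + M.marg a)).and
      (Ioo_mem_nhdsGT ha)).exists
  have hub : (M.psi c ξ₀ (⟨a, ha⟩, z)).toReal ≤ M.marg ξ₀ := by
    refine ENNReal.toReal_le_of_le_ofReal (M.marg_pos h₀0).le ?_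
    refine le_trans (max_le ?_ ?_) (ENNReal.ofReal_le_ofReal h₀)
    · refine (hB z (a - ξ₀) (by linarith)).trans ?_
      rw [← ENNReal.ofReal_coe_nnreal]
      exact ENNReal.ofReal_le_ofReal (by linarith [M.marg_pos ha])
    · exact ENNReal.ofReal_le_ofReal (by linarith [B.2])
  have hlb : M.marg a ≤ (M.psi c a (⟨a, ha⟩, z)).toReal := by
    rw [← ENNReal.ofReal_le_iff_le_toReal (hfin a le_rfl)]
    exact le_max_right _ _
  obtain ⟨ξ, hξ, h⟩ := intermediate_value_Icc' h₀a.le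
    (hreal.mono fun ξ h => ⟨h₀0.trans_le h.1, h.2⟩)
    (show (0 : ℝ) ∈ _ from ⟨by linarith, by linarith⟩)
  refine ⟨ξ, h₀0.trans_le hξ.1, hξ.2, ?_⟩
  rw [sub_eq_zero.1 h, ENNReal.ofReal_toReal (hfin ξ hξ.2)]

/-- The solutions of the Euler equation form a candidate policy. -/
theorem IsCandidate.of_solvesEuler {C : ℝ≥0∞} (hC : M.BoundedMarg C) {c d : State Z → ℝ}
    (hc : M.IsCandidate c) (hd : ∀ s, M.SolvesEuler c s (d s)) : M.IsCandidate d := by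
  have hmono : ∀ z : Z, Monotone fun a : Set.Ioi (0 : ℝ) => d (a, z) := by
    intro z a b hab
    by_contra! hlt
    have ha := hd (a, z)
    have hb := hd (b, z)
    have hab' : (a : ℝ) ≤ b := hab
    have h1 := M.marg_strictAntiOn (Set.mem_Ioi.2 hb.1) (Set.mem_Ioi.2 ha.1) hlt
    have h2 : M.psi c (d (b, z)) (b, z) ≤ M.psi c (d (a, z)) (a, z) := by
      refine max_le_max (hc.antitone_expMarg _ (by dsimp only; linarith))
        (ENNReal.ofReal_le_ofReal ?_)
      exact M.marg_strictAntiOn.antitoneOn a.2 b.2 hab'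
    rw [← ha.2.2, ← hb.2.2, ENNReal.ofReal_le_ofReal_iff (M.marg_pos ha.1).le] at h2
    linarith
  -- Savings also increase in assets. Together with `hmono` this makes `d` 1-Lipschitz in `a`,
  -- whence its continuity.
  have hsav : ∀ z : Z, ∀ a b : Set.Ioi (0 : ℝ), a ≤ b → d (b, z) - d (a, z) ≤ (b : ℝ) - a := by
    intro z a b hab
    by_contra! hlt
    have ha := hd (a, z)
    have hb := hd (b, z)
    have hab' : (a : ℝ) ≤ b := hab
    have h1 := M.marg_strictAntiOn (Set.mem_Ioi.2 ha.1) (Set.mem_Ioi.2 hb.1) (by linarith)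
    have hba := hb.2.1
    have haa := ha.2.1
    dsimp only at hba haa
    have h2 : ENNReal.ofReal (M.marg (d (a, z))) ≤ ENNReal.ofReal (M.marg (d (b, z))) := by
      rw [ha.2.2, hb.2.2]
      refine max_le (le_max_of_le_left (hc.antitone_expMarg _ (by dsimp only; linarith))) ?_
      -- If `u'(a)` exceeds the right side at `b`, then it is also the binding term at `a`, so all
      -- of `a` is consumed there; `hlt` would then push consumption at `b` above `b`.
      by_contra! h3
      have h4 := (le_max_left _ _).trans_lt h3
      have h5 : ENNReal.ofReal (M.marg (d (a, z))) ≤ ENNReal.ofReal (M.marg a) := by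
        rw [ha.2.2]
        refine max_le (le_trans (hc.antitone_expMarg _ (by dsimp only; linarith)) h4.le) le_rfl
      rw [ENNReal.ofReal_le_ofReal_iff (M.marg_pos a.2).le,
        M.marg_strictAntiOn.le_iff_ge (Set.mem_Ioi.2 ha.1) a.2] at h5
      linarith
    rw [ENNReal.ofReal_le_ofReal_iff (M.marg_pos hb.1).le] at h2
    linarith
  refine ⟨fun z => ?_, hmono, fun s => (hd s).1, fun s => (hd s).2.1, ?_⟩
  · refine LipschitzWith.continuous (K := 1) (LipschitzWith.of_le_add fun a b => ?_)
    rcases le_total a b with hab | hab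
    · exact (hmono z hab).trans (by simp)
    · have := hsav z b a hab
      have h2 : dist a b = (a : ℝ) - b := by
        rw [Subtype.dist_eq, Real.dist_eq, abs_of_nonneg (sub_nonneg.2 (show (b : ℝ) ≤ a from hab))]
      linarith
  · obtain ⟨B, hB⟩ := hc.exists_expMarg_le hC
    refine ⟨B, ?_⟩
    rintro _ ⟨s, rfl⟩
    have hs := hd s
    have h1 := M.marg_strictAntiOn.antitoneOn (Set.mem_Ioi.2 hs.1) s.1.2 hs.2.1
    have h2 := hs.2.2
    dsimp only
    rw [abs_of_nonneg (sub_nonneg.2 h1), sub_le_iff_le_add]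
    rw [← ENNReal.ofReal_le_ofReal_iff (add_nonneg (NNReal.coe_nonneg B) (M.marg_pos s.1.2).le), h2,
      ENNReal.ofReal_add (NNReal.coe_nonneg B) (M.marg_pos s.1.2).le, ENNReal.ofReal_coe_nnreal]
    refine max_le ?_ le_add_self
    exact (hB _ _ (sub_nonneg.2 hs.2.1)).trans le_self_add

/-! ### The time iteration operator and its contraction estimate. -/

theorem exists_timeIteration {C : ℝ≥0∞} (hC : M.BoundedMarg C) :
    ∃ T : M.Candidate → M.Candidate, M.IsTimeIteration T := by
  choose ξ hξ using fun (c : M.Candidate) (s : State Z) => c.2.exists_solvesEuler hC s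
  refine ⟨fun c => ⟨ξ c, IsCandidate.of_solvesEuler hC c.2 (hξ c)⟩, fun c s x => ⟨fun h => ?_, ?_⟩⟩
  · exact h.unique c.2 (hξ c s)
  · rintro rfl
    exact hξ c s

theorem IsTimeIteration.solvesEuler {T : M.Candidate → M.Candidate} (hT : M.IsTimeIteration T)
    (c : M.Candidate) (s : State Z) : M.SolvesEuler c s (T c s) := (hT c s _).2 rfl

/-- If `ξ ≥ η` there is nothing to prove. If `ξ < η`, then `c` leaves more savings; lowering them to
`a - η` only raises the expected marginal value, and at equal savings the two right sides differ by
at most the image of `v`. -/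
theorem margAt_solution_le {c d : M.Candidate} {v : Z → ℝ≥0∞}
    (hv : ∀ a z, M.margAt c a z ≤ M.margAt d a z + v z) {s : State Z} {ξ η : ℝ}
    (hξ : M.SolvesEuler c s ξ) (hη : M.SolvesEuler d s η) :
    ENNReal.ofReal (M.marg ξ) ≤ ENNReal.ofReal (M.marg η)
      + M.op (fun x => M.disc x * M.ret x) v s.2 := by
  rcases le_or_gt η ξ with h | h
  · exact le_add_right (ENNReal.ofReal_le_ofReal
      (M.marg_strictAntiOn.antitoneOn (Set.mem_Ioi.2 hη.1) (Set.mem_Ioi.2 hξ.1) h))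
  · rw [hξ.2.2, hη.2.2]
    refine max_le ?_ (le_add_right (le_max_right _ _))
    have hle : s.1.1 - η ≤ s.1.1 - ξ := by linarith
    refine (c.2.antitone_expMarg s.2 hle).trans ?_
    refine le_trans (b := M.expMarg d s.2 (s.1 - η) + M.op (fun x => M.disc x * M.ret x) v s.2) ?_
      (add_le_add (le_max_left _ _) le_rfl)
    unfold op expMarg
    rw [← lintegral_add_right _ (by fun_prop)]
    refine lintegral_mono fun x => ?_
    dsimp only
    rw [← mul_add]
    gcongr
    exact hv _ _

theorem IsTimeIteration.margAt_le {T : M.Candidate → M.Candidate} (hT : M.IsTimeIteration T)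
    {c d : M.Candidate} {v : Z → ℝ≥0∞}
    (hv : ∀ a z, M.margAt c a z ≤ M.margAt d a z + v z) (a : ℝ) (z : Z) :
    M.margAt (T c) a z ≤ M.margAt (T d) a z + M.op (fun x => M.disc x * M.ret x) v z := by
  rcases le_or_gt a 0 with ha | ha
  · simp [margAt_of_nonpos _ ha]
  · rw [(T c).2.margAt_of_pos ha, (T d).2.margAt_of_pos ha]
    exact margAt_solution_le (c := c) (d := d) (s := (⟨a, ha⟩, z)) hv
      (hT.solvesEuler c (⟨a, ha⟩, z)) (hT.solvesEuler d (⟨a, ha⟩, z))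

theorem IsTimeIteration.iterate_margAt_le {T : M.Candidate → M.Candidate}
    (hT : M.IsTimeIteration T) {c d : M.Candidate} {v : Z → ℝ≥0∞}
    (hv : ∀ a z, M.margAt c a z ≤ M.margAt d a z + v z) (n : ℕ) (a : ℝ) (z : Z) :
    M.margAt (T^[n] c) a z
      ≤ M.margAt (T^[n] d) a z + (M.op fun x => M.disc x * M.ret x)^[n] v z := by
  induction n generalizing a z with
  | zero => exact hv a z
  | succ n ih =>
    simp only [Function.iterate_succ_apply']
    exact hT.margAt_le ih a z

theorem Candidate.abs_marg_sub_le_dist (c d : M.Candidate) (s : State Z) :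
    |M.marg (c s) - M.marg (d s)| ≤ dist c d := le_ciSup (M.bddAbove_marg_sub c d) s

theorem Candidate.margAt_le_add_dist (c d : M.Candidate) (a : ℝ) (z : Z) :
    M.margAt c a z ≤ M.margAt d a z + ENNReal.ofReal (dist c d) := by
  rcases le_or_gt a 0 with ha | ha
  · simp [margAt_of_nonpos _ ha]
  · rw [c.2.margAt_of_pos ha, d.2.margAt_of_pos ha,
      ← ENNReal.ofReal_add (M.marg_pos (d.2.pos _)).le dist_nonneg]
    have := le_of_abs_le (c.abs_marg_sub_le_dist d (⟨a, ha⟩, z))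
    exact ENNReal.ofReal_le_ofReal (by linarith)

theorem Candidate.dist_le_of_margAt_le {c d : M.Candidate} {r : ℝ} (hr : 0 ≤ r)
    (h : ∀ a z, M.margAt c a z ≤ M.margAt d a z + ENNReal.ofReal r)
    (h' : ∀ a z, M.margAt d a z ≤ M.margAt c a z + ENNReal.ofReal r) : dist c d ≤ r := by
  have key : ∀ c d : M.Candidate, (∀ a z, M.margAt c a z ≤ M.margAt d a z + ENNReal.ofReal r) →
      ∀ s, M.marg (c s) - M.marg (d s) ≤ r := fun c d h s => by
    have h1 := h s.1 s.2
    rw [c.2.margAt_of_pos s.1.2, d.2.margAt_of_pos s.1.2,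
      ← ENNReal.ofReal_add (M.marg_pos (d.2.pos _)).le hr,
      ENNReal.ofReal_le_ofReal_iff (add_nonneg (M.marg_pos (d.2.pos _)).le hr)] at h1
    change M.marg (c s) ≤ M.marg (d s) + r at h1
    linarith
  refine Real.iSup_le (fun s => abs_le.2 ⟨?_, key c d h s⟩) hr
  linarith [key d c h' s]

/-- The initial weight is the constant `ρ(c, d)`, which homogeneity pulls out of the iterated
operator. -/
theorem IsTimeIteration.dist_iterate_le {T : M.Candidate → M.Candidate} (hT : M.IsTimeIteration T)
    {n : ℕ} {q : ℝ≥0} (hq : ∀ z, (M.op fun x => M.disc x * M.ret x)^[n] 1 z ≤ q)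
    (c d : M.Candidate) : dist (T^[n] c) (T^[n] d) ≤ q * dist c d := by
  have key : ∀ c d : M.Candidate, ∀ a z, M.margAt (T^[n] c) a z
      ≤ M.margAt (T^[n] d) a z + ENNReal.ofReal (q * dist c d) := fun c d a z => by
    refine (hT.iterate_margAt_le (c.margAt_le_add_dist d) n a z).trans ?_
    rw [op_iterate_const (by fun_prop), mul_comm (q : ℝ), ENNReal.ofReal_mul dist_nonneg,
      ENNReal.ofReal_coe_nnreal]
    exact add_le_add le_rfl (mul_le_mul_right (hq z) _)
  refine Candidate.dist_le_of_margAt_le (mul_nonneg q.2 dist_nonneg) (key c d) ?_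
  rw [dist_comm c d]
  exact key d c

/-! ### Completeness of the candidate space. -/

instance : Nonempty M.Candidate :=
  ⟨fun s => s.1, fun _ => continuous_subtype_val, fun _ _ _ h => h, fun s => s.1.2,
    fun _ => le_rfl, ⟨0, by rintro _ ⟨s, rfl⟩; simp⟩⟩

-- A strictly monotone map with connected range is an embedding, so continuity of `u' ∘ d` gives
-- continuity of `d`. The sign turns the decreasing `u'` into an increasing map.
variable (M) in
theorem isEmbedding_neg_marg : IsEmbedding fun x : Set.Ioi (0 : ℝ) => -M.marg x := by
  refine StrictMono.isEmbedding_of_ordConnected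
    (fun x y h => neg_lt_neg (M.marg_strictAntiOn x.2 y.2 h)) ?_
  have h1 : IsPreconnected (Set.range fun x : Set.Ioi (0 : ℝ) => -M.marg x) := by
    rw [show (fun x : Set.Ioi (0 : ℝ) => -M.marg x) = (fun x => -M.marg x) ∘ Subtype.val from rfl,
      Set.range_comp, Subtype.range_coe]
    exact isPreconnected_Ioi.image _ M.continuousOn_marg.neg
  exact h1.ordConnected

variable (M) in
theorem exists_marg_eq {a y : ℝ} (ha : 0 < a) (hy : M.marg a ≤ y) :
    ∃ x, 0 < x ∧ x ≤ a ∧ M.marg x = y := by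
  obtain ⟨x₀, h₀, h₀0, h₀a⟩ : ∃ x₀, y ≤ M.marg x₀ ∧ 0 < x₀ ∧ x₀ < a :=
    ((M.tendsto_deriv_u.eventually_ge_atTop y).and (Ioo_mem_nhdsGT ha)).exists
  obtain ⟨x, hx, h⟩ := intermediate_value_Icc' h₀a.le
    (M.continuousOn_marg.mono fun x h => h₀0.trans_le h.1) (show y ∈ _ from ⟨hy, h₀⟩)
  exact ⟨x, h₀0.trans_le hx.1, hx.2, h⟩

/-- The metric is the uniform one on `u' ∘ c`. A uniform limit `f` satisfies `f ≥ u'(a)`, and since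
`u'` is continuous and blows up at `0`, it has the form `u' ∘ d` with `0 < d ≤ a`. -/
instance : CompleteSpace M.Candidate := by
  refine Metric.complete_of_cauchySeq_tendsto fun c hc => ?_
  obtain ⟨b, hb0, hb, hblim⟩ := cauchySeq_iff_le_tendsto_0.1 hc
  have hpt : ∀ s, CauchySeq fun n => M.marg (c n s) := fun s =>
    cauchySeq_iff_le_tendsto_0.2 ⟨b, hb0, fun n m N hn hm =>
      ((c n).abs_marg_sub_le_dist (c m) s).trans (hb n m N hn hm), hblim⟩
  choose f hf using fun s => cauchySeq_tendsto_of_complete (hpt s)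
  have hfb : ∀ n s, |M.marg (c n s) - f s| ≤ b n := fun n s => by
    refine le_of_tendsto ((tendsto_const_nhds.sub (hf s)).abs) ?_
    filter_upwards [eventually_ge_atTop n] with m hm
    exact ((c n).abs_marg_sub_le_dist (c m) s).trans (hb n m n le_rfl hm)
  have hfge : ∀ s : State Z, M.marg s.1 ≤ f s := fun s =>
    ge_of_tendsto' (hf s) fun n =>
      M.marg_strictAntiOn.antitoneOn (Set.mem_Ioi.2 ((c n).2.pos s)) s.1.2 ((c n).2.le s)
  choose d hd0 hda hd using fun s : State Z => M.exists_marg_eq s.1.2 (hfge s)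
  have hdc : M.IsCandidate d := by
    refine ⟨fun z => ?_, fun z a a' haa => ?_, hd0, hda, ?_⟩
    · have h1 : Continuous fun a : Set.Ioi (0 : ℝ) => f (a, z) := by
        have hu : TendstoUniformly (fun n (a : Set.Ioi (0 : ℝ)) => M.marg (c n (a, z)))
            (fun a => f (a, z)) atTop := by
          rw [Metric.tendstoUniformly_iff]
          intro ε hε
          filter_upwards [hblim.eventually_lt_const hε] with n hn a
          rw [dist_comm, Real.dist_eq]
          exact (hfb n _).trans_lt hn
        refine hu.continuous (Frequently.of_forall fun n => ?_)
        exact M.continuousOn_marg.comp_continuous ((c n).2.continuous z) fun a => (c n).2.pos _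
      have h2 : Continuous fun a : Set.Ioi (0 : ℝ) => (⟨d (a, z), hd0 _⟩ : Set.Ioi (0 : ℝ)) := by
        rw [M.isEmbedding_neg_marg.continuous_iff]
        exact h1.neg.congr fun a => by simp [hd]
      exact continuous_subtype_val.comp h2
    · rw [← M.marg_strictAntiOn.le_iff_ge (hd0 _) (hd0 _), hd, hd]
      exact le_of_tendsto_of_tendsto' (hf _) (hf _) fun n =>
        M.marg_strictAntiOn.antitoneOn (Set.mem_Ioi.2 ((c n).2.pos _))
          (Set.mem_Ioi.2 ((c n).2.pos _)) ((c n).2.monotone z haa)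
    · obtain ⟨A, hA⟩ := (c 0).2.bdd
      refine ⟨b 0 + A, ?_⟩
      rintro _ ⟨s, rfl⟩
      have h1 : |M.marg (c 0 s) - M.marg s.1| ≤ A := hA ⟨s, rfl⟩
      have h2 := hfb 0 s
      rw [abs_sub_comm] at h2
      dsimp only
      rw [hd]
      exact (abs_sub_le _ (M.marg (c 0 s)) _).trans (add_le_add h2 h1)
  refine ⟨⟨d, hdc⟩, tendsto_iff_dist_tendsto_zero.2 (squeeze_zero (fun _ => dist_nonneg)
    (fun n => Real.iSup_le (fun s => ?_) (hb0 n)) hblim)⟩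
  change |M.marg (c n s) - M.marg (d s)| ≤ b n
  rw [hd]
  exact hfb n s

end TimeIteration

/-! ### Concavity of utility and bounds by marginal utility. -/

section Utility

variable (M : IncomeFluctuation Z E F H)

theorem coe_toReal_u {x : ℝ} (hx : 0 < x) : ((M.u x).toReal : EReal) = M.u x :=
  EReal.coe_toReal (M.u_ne_top x hx) (M.u_ne_bot x hx)

/-- Strict concavity of utility: the graph lies below its tangents. -/
theorem toReal_u_lt_tangent {x y : ℝ} (hx : 0 < x) (hy : 0 < y) (hne : y ≠ x) :
    (M.u y).toReal < (M.u x).toReal + M.marg x * (y - x) := by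
  have hmvt : ∀ {a b : ℝ}, 0 < a → a < b → ∃ c, a < c ∧ c < b ∧
      (M.u b).toReal - (M.u a).toReal = M.marg c * (b - a) := fun {a b} ha hab => by
    obtain ⟨c, hc, h⟩ := exists_deriv_eq_slope (fun y => (M.u y).toReal) hab
      (fun w hw => (M.differentiableAt_u w (ha.trans_le hw.1)).continuousAt.continuousWithinAt)
      (fun w hw => (M.differentiableAt_u w (ha.trans hw.1)).differentiableWithinAt)
    refine ⟨c, hc.1, hc.2, ?_⟩
    rw [marg, h, div_mul_cancel₀ _ (sub_pos.2 hab).ne']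
  rcases hne.lt_or_gt with h | h
  · obtain ⟨c, hyc, hcx, he⟩ := hmvt hy h
    have := M.marg_strictAntiOn (Set.mem_Ioi.2 (hy.trans hyc)) (Set.mem_Ioi.2 hx) hcx
    nlinarith [mul_lt_mul_of_pos_right this (sub_pos.2 h)]
  · obtain ⟨c, hxc, hcy, he⟩ := hmvt hx h
    have := M.marg_strictAntiOn (Set.mem_Ioi.2 hx) (Set.mem_Ioi.2 (hx.trans hxc)) hxc
    nlinarith [mul_lt_mul_of_pos_right this (sub_pos.2 h)]

theorem toReal_u_le_tangent {x y : ℝ} (hx : 0 < x) (hy : 0 < y) :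
    (M.u y).toReal ≤ (M.u x).toReal + M.marg x * (y - x) := by
  rcases eq_or_ne y x with rfl | h
  · simp
  · exact (M.toReal_u_lt_tangent hx hy h).le

theorem u_mono {x y : ℝ} (hx : 0 ≤ x) (hxy : x ≤ y) : M.u x ≤ M.u y := by
  rcases hxy.eq_or_lt with rfl | hlt
  · exact le_rfl
  rcases hx.eq_or_lt with rfl | hx
  · exact M.u_zero_le y hlt
  · have hy := hx.trans hlt
    rw [← M.coe_toReal_u hx, ← M.coe_toReal_u hy, EReal.coe_le_coe_iff]
    have h1 := M.toReal_u_le_tangent hy hx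
    nlinarith [mul_pos (M.marg_pos hy) (sub_pos.2 hlt)]

/-- Utility is controlled only on `[0, ∞)`; truncating its argument at `0` makes it monotone on all
of `ℝ`, hence measurable. -/
theorem measurable_toENNReal_u {α : Type*} [MeasurableSpace α] {f : α → ℝ} (hf : Measurable f)
    (h0 : ∀ x, 0 ≤ f x) : Measurable fun x => (M.u (f x)).toENNReal := by
  have h1 : Monotone fun x : ℝ => (M.u (max x 0)).toENNReal := fun x y hxy =>
    EReal.toENNReal_le_toENNReal (M.u_mono (le_max_right _ _) (max_le_max hxy le_rfl))
  have h2 := h1.measurable.comp hf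
  simpa only [Function.comp_def, max_eq_left (h0 _)] using h2

theorem measurable_toENNReal_neg_u {α : Type*} [MeasurableSpace α] {f : α → ℝ}
    (hf : Measurable f) (h0 : ∀ x, 0 ≤ f x) : Measurable fun x => (-M.u (f x)).toENNReal := by
  have h1 : Antitone fun x : ℝ => (-M.u (max x 0)).toENNReal := fun x y hxy =>
    EReal.toENNReal_le_toENNReal
      (EReal.neg_le_neg_iff.2 (M.u_mono (le_max_right _ _) (max_le_max hxy le_rfl)))
  have h2 := h1.measurable.comp hf
  simpa only [Function.comp_def, max_eq_left (h0 _)] using h2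

/-- The tangent at `1` is an affine majorant, so positive parts of utility are controlled by assets.
-/
theorem toENNReal_u_le {x : ℝ} (hx : 0 ≤ x) :
    (M.u x).toENNReal ≤ ENNReal.ofReal |(M.u 1).toReal| + ENNReal.ofReal (M.marg 1) *
      ENNReal.ofReal x := by
  have h1 := M.marg_pos one_pos
  have h2 : (M.u x).toENNReal ≤ ENNReal.ofReal (|(M.u 1).toReal| + M.marg 1 * x) := by
    rcases hx.eq_or_lt with rfl | hx
    · refine (EReal.toENNReal_le_toENNReal (M.u_zero_le 1 one_pos)).trans ?_
      rw [← M.coe_toReal_u one_pos, EReal.real_coe_toENNReal]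
      refine ENNReal.ofReal_le_ofReal ?_
      simpa using le_abs_self _
    · rw [← M.coe_toReal_u hx, EReal.real_coe_toENNReal]
      refine ENNReal.ofReal_le_ofReal ?_
      nlinarith [M.toReal_u_le_tangent one_pos hx, le_abs_self (M.u 1).toReal]
  rwa [ENNReal.ofReal_add (abs_nonneg _) (by positivity), ENNReal.ofReal_mul h1.le] at h2

/-- The tangent at `x`, evaluated at `1`, bounds `-u(x)` by `u'(x) - u(1)`. Integrable marginal
utility thus replaces a lower bound on `u`. -/
theorem toENNReal_neg_u_le {x : ℝ} (hx : 0 < x) :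
    (-M.u x).toENNReal ≤ ENNReal.ofReal |(M.u 1).toReal| + M.margExt x := by
  have h1 := M.marg_pos hx
  rw [M.margExt_of_pos hx, ← ENNReal.ofReal_add (abs_nonneg _) h1.le, ← M.coe_toReal_u hx,
    ← EReal.coe_neg, EReal.real_coe_toENNReal]
  refine ENNReal.ofReal_le_ofReal ?_
  nlinarith [M.toReal_u_le_tangent hx one_pos, neg_abs_le (M.u 1).toReal, mul_pos h1 hx]

theorem ofReal_add_ofReal_neg_le {p q a b δ : ℝ} (ha : 0 ≤ a) (hb : 0 ≤ b) (hδ : 0 ≤ δ)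
    (h : p + a + δ ≤ q + b) :
    ENNReal.ofReal p + ENNReal.ofReal (-q) + ENNReal.ofReal a + ENNReal.ofReal δ
      ≤ ENNReal.ofReal q + ENNReal.ofReal (-p) + ENNReal.ofReal b := by
  have hmax : ∀ r : ℝ, ENNReal.ofReal r = ENNReal.ofReal (max r 0) := fun r => by simp
  have hsub : ∀ r : ℝ, max r 0 - max (-r) 0 = r := fun r => by
    rcases le_total r 0 with hr | hr <;> simp [hr]
  rw [hmax p, hmax q, hmax (-p), hmax (-q),
    ← ENNReal.ofReal_add (by positivity) (by positivity),
    ← ENNReal.ofReal_add (by positivity) (by positivity),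
    ← ENNReal.ofReal_add (by positivity) (by positivity),
    ← ENNReal.ofReal_add (by positivity) (by positivity),
    ← ENNReal.ofReal_add (by positivity) (by positivity)]
  exact ENNReal.ofReal_le_ofReal (by linarith [hsub p, hsub q])

/-- Strict concavity of utility, in terms of positive and negative parts. -/
theorem exists_toENNReal_u_tangent {x y : ℝ} (hx : 0 < x) (hy : 0 < y) (hne : y ≠ x) :
    ∃ δ : ℝ≥0∞, δ ≠ 0 ∧ (M.u y).toENNReal + (-M.u x).toENNReal + M.margExt x * ENNReal.ofReal x + δ
      ≤ (M.u x).toENNReal + (-M.u y).toENNReal + M.margExt x * ENNReal.ofReal y := by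
  have h := M.toReal_u_lt_tangent hx hy hne
  have h1 := M.marg_pos hx
  refine ⟨ENNReal.ofReal ((M.u x).toReal + M.marg x * (y - x) - (M.u y).toReal), ?_, ?_⟩
  · simpa using h
  · rw [M.margExt_of_pos hx, ← ENNReal.ofReal_mul h1.le, ← ENNReal.ofReal_mul h1.le,
      ← M.coe_toReal_u hx, ← M.coe_toReal_u hy, ← EReal.coe_neg, ← EReal.coe_neg]
    simp only [EReal.real_coe_toENNReal, EReal.toReal_coe]
    exact ofReal_add_ofReal_neg_le (by positivity) (by positivity) (by linarith) (by linarith)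

/-- Concavity of utility, in terms of positive and negative parts. -/
theorem toENNReal_u_tangent {x y : ℝ} (hx : 0 < x) (hy : 0 ≤ y) :
    (M.u y).toENNReal + (-M.u x).toENNReal + M.margExt x * ENNReal.ofReal x
      ≤ (M.u x).toENNReal + (-M.u y).toENNReal + M.margExt x * ENNReal.ofReal y := by
  have h1 := M.marg_pos hx
  rcases eq_or_ne (M.u y) ⊥ with hbot | hbot
  · simp [hbot]
  have htop : M.u y ≠ ⊤ := ne_top_of_le_ne_top (M.u_ne_top (y + 1) (by linarith))
    (M.u_mono hy (by linarith))
  have hcoe := EReal.coe_toReal htop hbot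
  -- At `y = 0` utility need not be continuous. Monotonicity gives `u(y) ≤ u(w)` for `w > y`, and
  -- only the affine right side has to pass to the limit `w ↓ y`.
  have key : (M.u y).toReal ≤ (M.u x).toReal + M.marg x * (y - x) := by
    have h2 : Tendsto (fun w => (M.u x).toReal + M.marg x * (w - x)) (𝓝[>] y)
        (𝓝 ((M.u x).toReal + M.marg x * (y - x))) := by
      have : Continuous fun w => (M.u x).toReal + M.marg x * (w - x) := by fun_prop
      exact this.continuousAt.mono_left nhdsWithin_le_nhds
    refine ge_of_tendsto h2 ?_
    filter_upwards [self_mem_nhdsWithin] with w hw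
    have hyw : y < w := hw
    refine le_trans ?_ (M.toReal_u_le_tangent hx (hy.trans_lt hyw))
    exact EReal.toReal_le_toReal (M.u_mono hy hyw.le) hbot (M.u_ne_top w (hy.trans_lt hyw))
  rw [M.margExt_of_pos hx, ← ENNReal.ofReal_mul h1.le, ← ENNReal.ofReal_mul h1.le,
    ← M.coe_toReal_u hx, ← hcoe, ← EReal.coe_neg, ← EReal.coe_neg]
  simp only [EReal.real_coe_toENNReal]
  simpa using ofReal_add_ofReal_neg_le (δ := 0) (by positivity) (by positivity) le_rfl
    (show (M.u y).toReal + M.marg x * x + 0 ≤ (M.u x).toReal + M.marg x * y by linarith)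

/-- Below `1` the factor `a` is harmless; above `1` marginal utility is at most `u'(1)`. This
separates the value of assets into two parts with known moments. -/
theorem margExt_mul_le (a : ℝ) :
    M.margExt a * ENNReal.ofReal a
      ≤ M.margExt a + ENNReal.ofReal (M.marg 1) * ENNReal.ofReal a := by
  rcases le_total a 1 with h | h
  · refine le_add_right ?_
    exact mul_le_of_le_one_right' (by simpa using h)
  · refine le_add_left ?_
    gcongr
    rw [← M.margExt_of_pos one_pos]
    exact M.antitone_margExt h

end Utility

/-! ### Asset paths of feasible policies and discounted moments. -/

section Paths

variable {M : IncomeFluctuation Z E F H}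

theorem IsFeasible.extendPolicy_nonneg {Z : Type*} [MeasurableSpace Z] {d : State Z → ℝ}
    (hd : IsFeasible d) (a : ℝ) (z : Z) : 0 ≤ extendPolicy d a z := by
  rcases le_or_gt a 0 with ha | ha
  · rw [extendPolicy_of_nonpos d ha]
  · rw [extendPolicy_of_pos d ha]; exact (hd.2 _).1

theorem IsFeasible.extendPolicy_le {Z : Type*} [MeasurableSpace Z] {d : State Z → ℝ}
    (hd : IsFeasible d) {a : ℝ} (h : 0 ≤ a) (z : Z) : extendPolicy d a z ≤ a := by
  rcases le_or_gt a 0 with ha | ha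
  · rwa [extendPolicy_of_nonpos d ha]
  · rw [extendPolicy_of_pos d ha]; exact (hd.2 _).2

theorem IsFeasible.assets_nonneg {d : State Z → ℝ} (hd : IsFeasible d) {a : ℝ} (ha : 0 ≤ a)
    (ω : ℕ → Shock Z E F H) (t : ℕ) : 0 ≤ M.assets d a ω t := by
  induction t with
  | zero => exact ha
  | succ t ih =>
    exact add_nonneg (mul_nonneg (NNReal.coe_nonneg _) (sub_nonneg.2 (hd.extendPolicy_le ih _)))
      (NNReal.coe_nonneg _)

theorem IsFeasible.consumption_nonneg {d : State Z → ℝ} (hd : IsFeasible d) (a : ℝ)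
    (ω : ℕ → Shock Z E F H) (t : ℕ) : 0 ≤ M.consumption d a ω t :=
  hd.extendPolicy_nonneg _ _

theorem IsFeasible.consumption_le {d : State Z → ℝ} (hd : IsFeasible d) {a : ℝ} (ha : 0 ≤ a)
    (ω : ℕ → Shock Z E F H) (t : ℕ) : M.consumption d a ω t ≤ M.assets d a ω t :=
  hd.extendPolicy_le (hd.assets_nonneg ha ω t) _

theorem assets_succ (d : State Z → ℝ) (a : ℝ) (ω : ℕ → Shock Z E F H) (t : ℕ) :
    M.assets d a ω (t + 1) = M.ret (ω (t + 1)) * (M.assets d a ω t - M.consumption d a ω t)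
      + M.inc (ω (t + 1)) := rfl

theorem IsFeasible.inc_le_assets {d : State Z → ℝ} (hd : IsFeasible d) {a : ℝ} (ha : 0 ≤ a)
    (ω : ℕ → Shock Z E F H) (t : ℕ) : (M.inc (ω (t + 1)) : ℝ) ≤ M.assets d a ω (t + 1) := by
  rw [assets_succ]
  exact le_add_of_nonneg_left
    (mul_nonneg (NNReal.coe_nonneg _) (sub_nonneg.2 (hd.consumption_le ha ω t)))

@[fun_prop] theorem measurable_cumDisc (t : ℕ) : Measurable fun ω => M.cumDisc ω t := by
  unfold cumDisc; fun_prop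

theorem IsFeasible.measurable_assets {d : State Z → ℝ} (hd : IsFeasible d) (a : ℝ) (t : ℕ) :
    Measurable fun ω => M.assets d a ω t := by
  induction t with
  | zero => exact measurable_const
  | succ t ih =>
    have h1 : Measurable fun ω : ℕ → Shock Z E F H => extendPolicy d (M.assets d a ω t) (ω t).1 :=
      (measurable_extendPolicy hd.1).comp (ih.prodMk (by fun_prop))
    unfold assets
    fun_prop

theorem IsFeasible.measurable_consumption {d : State Z → ℝ} (hd : IsFeasible d) (a : ℝ) (t : ℕ) :
    Measurable fun ω => M.consumption d a ω t :=
  (measurable_extendPolicy hd.1).comp ((hd.measurable_assets a t).prodMk (by fun_prop))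

theorem cumDisc_congr {ω ω' : ℕ → Shock Z E F H} {t : ℕ} (h : ∀ i ≤ t, ω i = ω' i) :
    M.cumDisc ω t = M.cumDisc ω' t :=
  Finset.prod_congr rfl fun i hi => by rw [h i (Finset.mem_Icc.1 hi).2]

theorem assets_congr (d : State Z → ℝ) (a : ℝ) {ω ω' : ℕ → Shock Z E F H} {t : ℕ}
    (h : ∀ i ≤ t, ω i = ω' i) : M.assets d a ω t = M.assets d a ω' t := by
  induction t with
  | zero => rfl
  | succ t ih =>
    unfold assets
    rw [ih fun i hi => h i (by omega), h t (by omega), h (t + 1) le_rfl]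

theorem consumption_congr (d : State Z → ℝ) (a : ℝ) {ω ω' : ℕ → Shock Z E F H} {t : ℕ}
    (h : ∀ i ≤ t, ω i = ω' i) : M.consumption d a ω t = M.consumption d a ω' t := by
  rw [consumption, consumption, assets_congr d a h, h t le_rfl]

theorem cumDisc_succ (ω : ℕ → Shock Z E F H) (t : ℕ) :
    M.cumDisc ω (t + 1) = M.cumDisc ω t * M.disc (ω (t + 1)) :=
  Finset.prod_Icc_succ_top (Nat.le_add_left 1 t) _

theorem lintegral_cumDisc_succ (ν : PMF Z) (t : ℕ)
    {g : (ℕ → Shock Z E F H) → Shock Z E F H → ℝ≥0∞} (hg : Measurable (Function.uncurry g))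
    (hdep : ∀ ω ω', (∀ i ≤ t, ω i = ω' i) → g ω = g ω') :
    ∫⁻ ω, (M.cumDisc ω (t + 1) : ℝ≥0∞) * g ω (ω (t + 1)) ∂M.pathLaw ν
      = ∫⁻ ω, (M.cumDisc ω t : ℝ≥0∞) * ∫⁻ x, (M.disc x : ℝ≥0∞) * g ω x ∂M.stepKernel (ω t).1
        ∂M.pathLaw ν := by
  have h := M.lintegral_pathLaw_step ν t
    (f := fun ω x => (M.cumDisc ω t : ℝ≥0∞) * ((M.disc x : ℝ≥0∞) * g ω x))
    (((measurable_cumDisc t).comp measurable_fst).coe_nnreal_ennreal.mul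
      ((M.measurable_disc.comp measurable_snd).coe_nnreal_ennreal.mul hg))
    (fun ω ω' hω => by funext x; rw [cumDisc_congr hω, hdep ω ω' hω])
  simp only [cumDisc_succ, ENNReal.coe_mul, mul_assoc]
  rw [h]
  refine lintegral_congr fun ω => ?_
  rw [lintegral_const_mul]
  exact M.measurable_disc.coe_nnreal_ennreal.mul hg.of_uncurry_left

variable (M) in
/-- Moment and stability conditions on the exogenous processes, uniform over the states. -/
structure Stable (C : ℝ≥0∞) : Prop extends M.BoundedMarg C where
  lintegral_inc_le : ∀ z, ∫⁻ h, (M.Y (z, h) : ℝ≥0∞) ∂(M.lawH : Measure H) ≤ C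
  tsum_disc_ne_top : ∀ z, ∑' n, (M.op M.disc)^[n] 1 z ≠ ⊤
  tsum_disc_ret_ne_top : ∀ z, ∑' n, (M.op fun x => M.disc x * M.ret x)^[n] 1 z ≠ ⊤

theorem Stable.tsum_cumDisc_ne_top {C : ℝ≥0∞} (hC : M.Stable C) (z : Z) :
    ∑' t, ∫⁻ ω, (M.cumDisc ω t : ℝ≥0∞) ∂M.pathLaw (PMF.pure z) ≠ ⊤ := by
  refine (tsum_congr fun t => ?_).trans_ne (hC.tsum_disc_ne_top z)
  have := lintegral_prod_pathLaw (M := M) (PMF.pure z) M.measurable_disc t 1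
  rw [lintegral_toMeasure_pure] at this
  simpa [cumDisc] using this

/-- Given the state of the chain, the income innovation is independent of the discount factors, so
no joint moment of `β` and `Y` is needed. -/
theorem lintegral_cumDisc_inc_le {C : ℝ≥0∞} {g : ℝ≥0 → ℝ≥0∞} (hg : Measurable g)
    (hgC : ∀ z, ∫⁻ h, g (M.Y (z, h)) ∂(M.lawH : Measure H) ≤ C) (ν : PMF Z) (t : ℕ) :
    ∫⁻ ω, (M.cumDisc ω (t + 1) : ℝ≥0∞) * g (M.inc (ω (t + 1))) ∂M.pathLaw ν
      ≤ C * ∫⁻ ω, (M.cumDisc ω (t + 1) : ℝ≥0∞) ∂M.pathLaw ν := by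
  rw [lintegral_cumDisc_succ ν t (g := fun _ x => g (M.inc x))
    (by unfold Function.uncurry; fun_prop) (fun _ _ _ => rfl)]
  have h2 := lintegral_cumDisc_succ (M := M) ν t (g := fun _ _ => C)
    (by unfold Function.uncurry; fun_prop) (fun _ _ _ => rfl)
  rw [lintegral_mul_const _ (by fun_prop), mul_comm] at h2
  rw [h2]
  refine lintegral_mono fun ω => ?_
  refine mul_le_mul_right ?_ _
  rw [M.lintegral_stepKernel_inc _ (φ := fun x => (M.disc x : ℝ≥0∞)) (by fun_prop)
    (fun _ _ _ _ _ => rfl) hg]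
  refine lintegral_mono fun x => ?_
  dsimp only
  gcongr
  exact hgC _

/-- Expected discounted assets are summable along every feasible policy. -/
theorem Stable.tsum_assets_ne_top {C : ℝ≥0∞} (hC : M.Stable C) {d : State Z → ℝ}
    (hd : IsFeasible d) {a : ℝ} (ha : 0 ≤ a) (z : Z) :
    ∑' t, ∫⁻ ω, (M.cumDisc ω t : ℝ≥0∞) * ENNReal.ofReal (M.assets d a ω t)
      ∂M.pathLaw (PMF.pure z) ≠ ⊤ := by
  have hmul : Measurable fun x => M.disc x * M.ret x := by fun_prop
  -- The resolvent is a Lyapunov weight: with `V t` the mean of discounted assets times `w`, the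
  -- summand `1` in `w = 1 + op w` pays for the period-`t` term `m t`, and income adds only the
  -- summable `w y * (C * b t)`.
  obtain ⟨w, hwtop, hw⟩ := exists_resolvent hmul hC.tsum_disc_ret_ne_top
  have : Nonempty Z := ⟨z⟩
  obtain ⟨y, hy⟩ := exists_eq_ciSup_of_finite (f := w)
  have hwy : ∀ x, w x ≤ w y := fun x => hy ▸ le_iSup w x
  set μ := M.pathLaw (PMF.pure z)
  set A : ℕ → (ℕ → Shock Z E F H) → ℝ≥0∞ := fun t ω => ENNReal.ofReal (M.assets d a ω t) with hA
  have hAm : ∀ t, Measurable (A t) := fun t => (hd.measurable_assets a t).ennreal_ofReal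
  have hwm : ∀ t, Measurable fun ω : ℕ → Shock Z E F H => w (ω t).1 := fun t =>
    (Measurable.of_discrete (f := w)).comp (by fun_prop)
  have hwm' : Measurable fun x : Shock Z E F H => w x.1 :=
    (Measurable.of_discrete (f := w)).comp (by fun_prop)
  have hAsucc : ∀ t ω, A (t + 1) ω ≤ M.ret (ω (t + 1)) * A t ω + M.inc (ω (t + 1)) := fun t ω => by
    simp only [hA]
    rw [← ENNReal.ofReal_coe_nnreal, ← ENNReal.ofReal_coe_nnreal,
      ← ENNReal.ofReal_mul (NNReal.coe_nonneg _),
      ← ENNReal.ofReal_add (mul_nonneg (NNReal.coe_nonneg _) (hd.assets_nonneg ha ω t))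
        (NNReal.coe_nonneg _), assets_succ]
    refine ENNReal.ofReal_le_ofReal ?_
    gcongr
    linarith [hd.consumption_nonneg (M := M) a ω t]
  set b : ℕ → ℝ≥0∞ := fun t => ∫⁻ ω, (M.cumDisc ω (t + 1) : ℝ≥0∞) ∂μ with hb
  set m : ℕ → ℝ≥0∞ := fun t => ∫⁻ ω, (M.cumDisc ω t : ℝ≥0∞) * A t ω ∂μ with hm
  set V : ℕ → ℝ≥0∞ := fun t => ∫⁻ ω, (M.cumDisc ω t : ℝ≥0∞) * (A t ω * w (ω t).1) ∂μ with hV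
  have hstep : ∀ t, V (t + 1) + m t ≤ V t + w y * (C * b t) := fun t => by
    have h1 : V (t + 1) ≤ ∫⁻ ω, (M.cumDisc ω (t + 1) : ℝ≥0∞) *
          (M.ret (ω (t + 1)) * A t ω * w (ω (t + 1)).1) ∂μ
        + ∫⁻ ω, w y * ((M.cumDisc ω (t + 1) : ℝ≥0∞) * M.inc (ω (t + 1))) ∂μ := by
      have h2 := hAm t
      have h3 := hwm (t + 1)
      rw [← lintegral_add_right _ (by fun_prop)]
      refine lintegral_mono fun ω => ?_
      dsimp only
      calc (M.cumDisc ω (t + 1) : ℝ≥0∞) * (A (t + 1) ω * w (ω (t + 1)).1)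
          ≤ (M.cumDisc ω (t + 1) : ℝ≥0∞) *
            ((M.ret (ω (t + 1)) * A t ω + M.inc (ω (t + 1))) * w (ω (t + 1)).1) := by
            gcongr; exact hAsucc t ω
        _ = (M.cumDisc ω (t + 1) : ℝ≥0∞) * (M.ret (ω (t + 1)) * A t ω * w (ω (t + 1)).1)
            + w (ω (t + 1)).1 * ((M.cumDisc ω (t + 1) : ℝ≥0∞) * M.inc (ω (t + 1))) := by ring
        _ ≤ _ := by gcongr; exact hwy _
    have h2 : ∫⁻ ω, w y * ((M.cumDisc ω (t + 1) : ℝ≥0∞) * M.inc (ω (t + 1))) ∂μ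
        ≤ w y * (C * b t) := by
      rw [lintegral_const_mul _ (by fun_prop)]
      exact mul_le_mul_right (lintegral_cumDisc_inc_le (g := fun y => (y : ℝ≥0∞)) (by fun_prop)
        hC.lintegral_inc_le (PMF.pure z) t) _
    have h3 : ∫⁻ ω, (M.cumDisc ω (t + 1) : ℝ≥0∞) *
          (M.ret (ω (t + 1)) * A t ω * w (ω (t + 1)).1) ∂μ
        = ∫⁻ ω, (M.cumDisc ω t : ℝ≥0∞) *
          (A t ω * M.op (fun x => M.disc x * M.ret x) w (ω t).1) ∂μ := by
      rw [lintegral_cumDisc_succ _ t (g := fun ω x => M.ret x * A t ω * w x.1)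
        (((M.measurable_ret.comp measurable_snd).coe_nnreal_ennreal.mul
          ((hAm t).comp measurable_fst)).mul (hwm'.comp measurable_snd))
        (fun ω ω' h => by funext x; simp only [hA, assets_congr d a h])]
      refine lintegral_congr fun ω => ?_
      rw [op, ← lintegral_const_mul (A t ω) (by fun_prop)]
      congr 1
      refine lintegral_congr fun x => ?_
      push_cast
      ring
    have h4 : ∫⁻ ω, (M.cumDisc ω t : ℝ≥0∞) *
        (A t ω * M.op (fun x => M.disc x * M.ret x) w (ω t).1) ∂μ + m t = V t := by
      have h5 := hAm t
      rw [hm, hV, ← lintegral_add_right _ (by fun_prop)]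
      refine lintegral_congr fun ω => ?_
      rw [hw (ω t).1]
      ring
    calc V (t + 1) + m t ≤ _ + w y * (C * b t) + m t := by
          gcongr; exact h1.trans (add_le_add h3.le h2)
      _ = V t + w y * (C * b t) := by rw [← h4]; ring
  have hsum : ∀ T, V T + ∑ t ∈ Finset.range T, m t
      ≤ V 0 + w y * (C * ∑ t ∈ Finset.range T, b t) := fun T => by
    induction T with
    | zero => simp
    | succ T ih =>
      rw [Finset.sum_range_succ, Finset.sum_range_succ]
      calc V (T + 1) + (∑ t ∈ Finset.range T, m t + m T)
          = V (T + 1) + m T + ∑ t ∈ Finset.range T, m t := by ring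
        _ ≤ V T + w y * (C * b T) + ∑ t ∈ Finset.range T, m t := add_le_add (hstep T) le_rfl
        _ = V T + ∑ t ∈ Finset.range T, m t + w y * (C * b T) := by ring
        _ ≤ V 0 + w y * (C * ∑ t ∈ Finset.range T, b t) + w y * (C * b T) := by gcongr
        _ = _ := by ring
  have hV0 : V 0 ≠ ⊤ := by
    refine ne_top_of_le_ne_top (ENNReal.mul_ne_top ENNReal.ofReal_ne_top (hwtop y))
      (b := ENNReal.ofReal a * w y) ?_
    calc V 0 ≤ ∫⁻ _, ENNReal.ofReal a * w y ∂μ := by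
          refine lintegral_mono fun ω => ?_
          simp only [cumDisc, hA, assets]
          simp only [Finset.Icc_eq_empty_of_lt zero_lt_one, Finset.prod_empty, ENNReal.coe_one,
            one_mul]
          gcongr
          exact hwy _
      _ = _ := by
        have : IsProbabilityMeasure μ := by unfold μ pathLaw; infer_instance
        simp
  have hbtop : ∑' t, b t ≠ ⊤ :=
    ne_top_of_le_ne_top (hC.tsum_cumDisc_ne_top z)
      (ENNReal.tsum_comp_le_tsum_of_injective (add_left_injective 1) _)
  refine ne_top_of_le_ne_top (b := V 0 + w y * (C * ∑' t, b t)) (ENNReal.add_ne_top.2 ⟨hV0,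
    ENNReal.mul_ne_top (hwtop y) (ENNReal.mul_ne_top hC.ne_top hbtop)⟩) ?_
  refine ENNReal.tsum_le_of_sum_range_le fun T => ?_
  refine (le_add_self.trans (hsum T)).trans ?_
  gcongr
  exact ENNReal.sum_le_tsum _

end Paths

/-! ### Finiteness of values and transversality. -/

section Optimality

variable {M : IncomeFluctuation Z E F H}

instance (ν : PMF Z) : IsProbabilityMeasure (M.pathLaw ν) := by
  unfold pathLaw; infer_instance

variable (M) in
/-- Expected discounted sum of the positive parts of utility. -/
def posValue (c : State Z → ℝ) (s : State Z) : ℝ≥0∞ :=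
  ∫⁻ ω, ∑' t, (M.cumDisc ω t : ℝ≥0∞) * (M.u (M.consumption c s.1 ω t)).toENNReal
      ∂M.pathLaw (PMF.pure s.2)

variable (M) in
/-- Expected discounted sum of the negative parts of utility. -/
def negValue (c : State Z → ℝ) (s : State Z) : ℝ≥0∞ :=
  ∫⁻ ω, ∑' t, (M.cumDisc ω t : ℝ≥0∞) * (-M.u (M.consumption c s.1 ω t)).toENNReal
      ∂M.pathLaw (PMF.pure s.2)

theorem lifetimeValue_eq (c : State Z → ℝ) (s : State Z) :
    M.lifetimeValue c s = (M.posValue c s : EReal) - (M.negValue c s : EReal) := rfl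

theorem IsFeasible.posValue_eq {d : State Z → ℝ} (hd : IsFeasible d) (s : State Z) :
    M.posValue d s = ∑' t, ∫⁻ ω, (M.cumDisc ω t : ℝ≥0∞) *
      (M.u (M.consumption d s.1 ω t)).toENNReal ∂M.pathLaw (PMF.pure s.2) := by
  refine lintegral_tsum fun t => ?_
  have := M.measurable_toENNReal_u (hd.measurable_consumption (M := M) s.1 t)
    (fun ω => hd.consumption_nonneg _ ω t)
  fun_prop

theorem IsFeasible.negValue_eq {d : State Z → ℝ} (hd : IsFeasible d) (s : State Z) :
    M.negValue d s = ∑' t, ∫⁻ ω, (M.cumDisc ω t : ℝ≥0∞) *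
      (-M.u (M.consumption d s.1 ω t)).toENNReal ∂M.pathLaw (PMF.pure s.2) := by
  refine lintegral_tsum fun t => ?_
  have := M.measurable_toENNReal_neg_u (hd.measurable_consumption (M := M) s.1 t)
    (fun ω => hd.consumption_nonneg _ ω t)
  fun_prop

theorem Stable.posValue_ne_top {C : ℝ≥0∞} (hC : M.Stable C) {d : State Z → ℝ}
    (hd : IsFeasible d) (s : State Z) : M.posValue d s ≠ ⊤ := by
  rw [hd.posValue_eq]
  set k := ENNReal.ofReal |(M.u 1).toReal|
  set m := ENNReal.ofReal (M.marg 1)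
  refine ne_top_of_le_ne_top (b := k * ∑' t, ∫⁻ ω, (M.cumDisc ω t : ℝ≥0∞) ∂M.pathLaw (PMF.pure s.2)
    + m * ∑' t, ∫⁻ ω, (M.cumDisc ω t : ℝ≥0∞) * ENNReal.ofReal (M.assets d s.1 ω t)
      ∂M.pathLaw (PMF.pure s.2)) (ENNReal.add_ne_top.2
        ⟨ENNReal.mul_ne_top ENNReal.ofReal_ne_top (hC.tsum_cumDisc_ne_top s.2),
        ENNReal.mul_ne_top ENNReal.ofReal_ne_top
          (hC.tsum_assets_ne_top hd (le_of_lt s.1.2) s.2)⟩) ?_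
  rw [← ENNReal.tsum_mul_left, ← ENNReal.tsum_mul_left, ← ENNReal.tsum_add]
  refine ENNReal.tsum_le_tsum fun t => ?_
  have hm := hd.measurable_assets (M := M) s.1 t
  rw [← lintegral_const_mul _ (by fun_prop), ← lintegral_const_mul _ (by fun_prop),
    ← lintegral_add_right _ (by fun_prop)]
  refine lintegral_mono fun ω => ?_
  dsimp only
  have h1 := M.toENNReal_u_le (hd.consumption_nonneg (M := M) s.1 ω t)
  have h2 := ENNReal.ofReal_le_ofReal (hd.consumption_le (M := M) (le_of_lt s.1.2) ω t)
  calc (M.cumDisc ω t : ℝ≥0∞) * (M.u (M.consumption d s.1 ω t)).toENNReal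
      ≤ (M.cumDisc ω t : ℝ≥0∞) * (k + m * ENNReal.ofReal (M.assets d s.1 ω t)) :=
        mul_le_mul_right (h1.trans (add_le_add le_rfl (mul_le_mul_right h2 _))) _
    _ = _ := by ring

theorem cumDisc_zero (ω : ℕ → Shock Z E F H) : M.cumDisc ω 0 = 1 := by
  simp [cumDisc]

theorem ae_pathLaw_pure_fst (z : Z) : ∀ᵐ ω ∂M.pathLaw (PMF.pure z), (ω 0).1 = z := by
  classical
  have h : ∫⁻ ω, (if (ω 0).1 = z then 0 else 1 : ℝ≥0∞) ∂M.pathLaw (PMF.pure z) = 0 := by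
    have hm : Measurable fun y : Z => if y = z then (0 : ℝ≥0∞) else 1 := Measurable.of_discrete
    rw [M.lintegral_pathLaw_zero (PMF.pure z)
      (f := fun x => if x.1 = z then (0 : ℝ≥0∞) else 1) (hm.comp measurable_fst),
      M.lintegral_shockLaw_fst (PMF.pure z) (fun y => if y = z then (0 : ℝ≥0∞) else 1),
      lintegral_toMeasure_pure]
    simp
  have hm : Measurable fun ω : ℕ → Shock Z E F H => if (ω 0).1 = z then (0 : ℝ≥0∞) else 1 :=
    (Measurable.of_discrete (f := fun y : Z => if y = z then (0 : ℝ≥0∞) else 1)).comp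
      (by fun_prop)
  rw [lintegral_eq_zero_iff hm] at h
  filter_upwards [h] with ω hω
  by_contra hne
  simp [hne] at hω

/-- Income is almost surely positive in every period. -/
theorem BoundedMarg.ae_inc_pos {C : ℝ≥0∞} (hC : M.BoundedMarg C) (ν : PMF Z) :
    ∀ᵐ ω ∂M.pathLaw ν, ∀ t, (0 : ℝ) < M.inc (ω (t + 1)) := by
  rw [ae_all_iff]
  intro t
  have h : ∫⁻ ω, M.margExt (M.inc (ω (t + 1))) ∂M.pathLaw ν ≠ ⊤ := by
    rw [M.lintegral_pathLaw_step ν t (f := fun _ x => M.margExt (M.inc x))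
      (by unfold Function.uncurry; fun_prop) (fun _ _ _ => rfl)]
    refine ne_top_of_le_ne_top hC.ne_top (b := C) ?_
    calc _ ≤ ∫⁻ _, C ∂M.pathLaw ν := by
          refine lintegral_mono fun ω => ?_
          have h2 := M.lintegral_stepKernel_inc (ω t).1 (φ := fun _ => 1) (by fun_prop) (by simp)
            (g := fun y => M.margExt y) (by fun_prop)
          simp only [one_mul] at h2
          dsimp only
          rw [h2]
          refine (lintegral_mono fun x : Shock Z E F H => hC.inc_le x.1).trans ?_
          simp
      _ = C := by simp
  filter_upwards [ae_lt_top (by fun_prop) h] with ω hω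
  exact M.margExt_lt_top_iff.1 hω

theorem IsFeasible.ae_assets_pos {C : ℝ≥0∞} (hC : M.BoundedMarg C) {d : State Z → ℝ}
    (hd : IsFeasible d) {a : ℝ} (ha : 0 < a) (ν : PMF Z) :
    ∀ᵐ ω ∂M.pathLaw ν, ∀ t, 0 < M.assets d a ω t := by
  filter_upwards [hC.ae_inc_pos ν] with ω hω t
  cases t with
  | zero => exact ha
  | succ t => exact (hω t).trans_le (hd.inc_le_assets ha.le ω t)

/-! ### The Euler inequality and optimality of the fixed point. -/

/-- The Euler equation, as a comparison of arbitrary savings `b` with optimal savings. -/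
theorem SolvesEuler.mul_add_le {c : State Z → ℝ} (hc : M.IsCandidate c)
    (hfix : ∀ s, M.SolvesEuler c s (c s)) {a : ℝ} (ha : 0 < a) (z : Z) (b : ℝ≥0∞) :
    M.expMarg c z (a - extendPolicy c a z) * b
        + M.margAt c a z * ENNReal.ofReal (a - extendPolicy c a z)
      ≤ M.margAt c a z * b
        + M.expMarg c z (a - extendPolicy c a z) * ENNReal.ofReal (a - extendPolicy c a z) := by
  have h := hfix (⟨a, ha⟩, z)
  have h1 : M.margAt c a z
      = max (M.expMarg c z (a - extendPolicy c a z)) (ENNReal.ofReal (M.marg a)) := by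
    rw [hc.margAt_of_pos ha, h.2.2, extendPolicy_of_pos c ha]
    rfl
  -- Complementary slackness: either savings vanish and the Euler inequality suffices, or `c(a, z) <
  -- a` excludes `u'(c) = u'(a)` and the Euler equation holds exactly.
  rcases (show c (⟨a, ha⟩, z) ≤ a from h.2.1).eq_or_lt with he | hlt
  · have h2 : a - extendPolicy c a z = 0 := by rw [extendPolicy_of_pos c ha, he, sub_self]
    rw [h2] at h1 ⊢
    simp only [ENNReal.ofReal_zero, mul_zero, add_zero]
    gcongr
    exact h1 ▸ le_max_left _ _
  · have h2 : M.margAt c a z = M.expMarg c z (a - extendPolicy c a z) := by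
      rcases le_total (ENNReal.ofReal (M.marg a)) (M.expMarg c z (a - extendPolicy c a z))
        with h3 | h3
      · rw [h1, max_eq_left h3]
      · rw [max_eq_right h3, hc.margAt_of_pos ha] at h1
        have h4 := M.marg_strictAntiOn (Set.mem_Ioi.2 h.1) (Set.mem_Ioi.2 ha) hlt
        rw [ENNReal.ofReal_eq_ofReal_iff (M.marg_pos h.1).le (M.marg_pos ha).le] at h1
        exact absurd h1 h4.ne'
    rw [h2]

/-- Savings, weighted by the discount factor and marginal utility along `c`: the integrated form of
the Euler equation. -/
theorem Candidate.lintegral_euler_le {c : M.Candidate} (hfix : ∀ s, M.SolvesEuler c s (c s))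
    {C : ℝ≥0∞} (hC : M.BoundedMarg C) {d : State Z → ℝ} (hd : IsFeasible d) {a : ℝ} (ha : 0 < a)
    (ν : PMF Z) (t : ℕ) :
    ∫⁻ ω, (M.cumDisc ω (t + 1) : ℝ≥0∞) * (M.margAt c (M.assets c a ω (t + 1)) (ω (t + 1)).1
        * ENNReal.ofReal (M.assets d a ω (t + 1))) ∂M.pathLaw ν
      + ∫⁻ ω, (M.cumDisc ω t : ℝ≥0∞) * (M.margAt c (M.assets c a ω t) (ω t).1
        * ENNReal.ofReal (M.assets c a ω t - M.consumption c a ω t)) ∂M.pathLaw ν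
    ≤ ∫⁻ ω, (M.cumDisc ω t : ℝ≥0∞) * (M.margAt c (M.assets c a ω t) (ω t).1
        * ENNReal.ofReal (M.assets d a ω t - M.consumption d a ω t)) ∂M.pathLaw ν
      + ∫⁻ ω, (M.cumDisc ω (t + 1) : ℝ≥0∞) * (M.margAt c (M.assets c a ω (t + 1)) (ω (t + 1)).1
        * ENNReal.ofReal (M.assets c a ω (t + 1))) ∂M.pathLaw ν := by
  have hcf := c.2.isFeasible
  have hmarg := measurable_margAt (M := M) c.2.measurable
  have hsm : ∀ {e : State Z → ℝ}, IsFeasible e → Measurable fun ω =>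
      M.assets e a ω t - M.consumption e a ω t := fun he =>
    (he.measurable_assets a t).sub (he.measurable_consumption a t)
  have hsj : ∀ {e : State Z → ℝ}, IsFeasible e →
      Measurable fun p : (ℕ → Shock Z E F H) × Shock Z E F H =>
        M.assets e a p.1 t - M.consumption e a p.1 t := fun he => (hsm he).comp measurable_fst
  have hm1 : Measurable fun p : (ℕ → Shock Z E F H) × Shock Z E F H =>
      M.margAt c (M.ret p.2 * (M.assets c a p.1 t - M.consumption c a p.1 t) + M.inc p.2)
        p.2.1 := by
    have := hsj hcf
    exact hmarg.comp (Measurable.prodMk (by fun_prop) (by fun_prop))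
  have hm2 : ∀ ω : ℕ → Shock Z E F H, Measurable fun x : Shock Z E F H =>
      M.margAt c (M.ret x * (M.assets c a ω t - M.consumption c a ω t) + M.inc x) x.1 := fun ω =>
    hm1.comp measurable_prodMk_left
  -- The priced value of next period's income. It is the same for both policies, since prices follow
  -- the path of `c` and income is exogenous.
  set y : (ℕ → Shock Z E F H) → ℝ≥0∞ := fun ω => ∫⁻ x, (M.disc x : ℝ≥0∞) *
    (M.margAt c (M.ret x * (M.assets c a ω t - M.consumption c a ω t) + M.inc x) x.1 * M.inc x)
    ∂M.stepKernel (ω t).1 with hy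
  have hnext : ∀ {e : State Z → ℝ}, IsFeasible e →
      ∫⁻ ω, (M.cumDisc ω (t + 1) : ℝ≥0∞) * (M.margAt c (M.assets c a ω (t + 1)) (ω (t + 1)).1
        * ENNReal.ofReal (M.assets e a ω (t + 1))) ∂M.pathLaw ν
      = ∫⁻ ω, (M.cumDisc ω t : ℝ≥0∞) *
        (M.expMarg c (ω t).1 (M.assets c a ω t - M.consumption c a ω t)
          * ENNReal.ofReal (M.assets e a ω t - M.consumption e a ω t) + y ω) ∂M.pathLaw ν := by
    intro e he
    have h1 := lintegral_cumDisc_succ (M := M) ν t (g := fun ω x =>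
      M.margAt c (M.ret x * (M.assets c a ω t - M.consumption c a ω t) + M.inc x) x.1
        * ENNReal.ofReal (M.ret x * (M.assets e a ω t - M.consumption e a ω t) + M.inc x))
      (hm1.mul (by
        have := hsj he
        fun_prop))
      (fun ω ω' h => by
        funext x
        simp only [assets_congr _ a h, consumption_congr _ a h])
    simp only [assets_succ]
    rw [h1]
    refine lintegral_congr fun ω => ?_
    have hm2 := hm2 ω
    have hs : 0 ≤ M.assets e a ω t - M.consumption e a ω t :=
      sub_nonneg.2 (he.consumption_le ha.le ω t)
    congr 1
    rw [hy, expMarg, ← lintegral_mul_const _ (by fun_prop), ← lintegral_add_left (by fun_prop)]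
    refine lintegral_congr fun x => ?_
    rw [ENNReal.ofReal_add (mul_nonneg (NNReal.coe_nonneg _) hs) (NNReal.coe_nonneg _),
      ENNReal.ofReal_mul (NNReal.coe_nonneg _), ENNReal.ofReal_coe_nnreal,
      ENNReal.ofReal_coe_nnreal]
    push_cast
    ring
  rw [hnext hd, hnext hcf]
  have hmt : ∀ {e : State Z → ℝ}, IsFeasible e → Measurable fun ω : ℕ → Shock Z E F H =>
      (M.cumDisc ω t : ℝ≥0∞) * (M.margAt c (M.assets c a ω t) (ω t).1
        * ENNReal.ofReal (M.assets e a ω t - M.consumption e a ω t)) := fun he => by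
    have h1 : Measurable fun ω : ℕ → Shock Z E F H => M.margAt c (M.assets c a ω t) (ω t).1 :=
      hmarg.comp ((hcf.measurable_assets a t).prodMk (by fun_prop))
    have h2 := hsm he
    fun_prop
  rw [← lintegral_add_right _ (hmt hcf), ← lintegral_add_left (hmt hd)]
  refine lintegral_mono_ae ?_
  filter_upwards [hcf.ae_assets_pos hC ha ν] with ω hω
  rw [← mul_add, ← mul_add]
  refine mul_le_mul_right ?_ _
  have h := SolvesEuler.mul_add_le c.2 hfix (hω t) (ω t).1
    (ENNReal.ofReal (M.assets d a ω t - M.consumption d a ω t))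
  calc _ = _ + y ω := add_right_comm _ _ _
    _ ≤ _ + y ω := add_le_add h le_rfl
    _ = _ := add_assoc _ _ _

/-- Expected discounted assets, weighted by marginal utility, are finite and vanish in the limit. -/
theorem Candidate.weighted_assets {C : ℝ≥0∞} (hC : M.Stable C) (c : M.Candidate) (s : State Z) :
    ∑' t, ∫⁻ ω, (M.cumDisc ω t : ℝ≥0∞) * (M.margAt c (M.assets c s.1 ω t) (ω t).1
      * ENNReal.ofReal (M.assets c s.1 ω t)) ∂M.pathLaw (PMF.pure s.2) ≠ ⊤ := by
  obtain ⟨K, hK⟩ := c.2.exists_margAt_le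
  have hcf := c.2.isFeasible
  have ha : (0 : ℝ) < s.1 := s.1.2
  set m := ENNReal.ofReal (M.marg 1) + K
  -- Period zero is split off because assets are known to be at least income only from period one
  -- on.
  rw [tsum_eq_zero_add' ENNReal.summable]
  refine ENNReal.add_ne_top.2 ⟨?_, ?_⟩
  · refine ne_top_of_le_ne_top (b := (M.margExt s.1 + K) * ENNReal.ofReal s.1)
      (ENNReal.mul_ne_top (ENNReal.add_ne_top.2 ⟨(M.margExt_lt_top_iff.2 ha).ne,
        ENNReal.coe_ne_top⟩) ENNReal.ofReal_ne_top) ?_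
    calc _ ≤ ∫⁻ _, (M.margExt s.1 + K) * ENNReal.ofReal s.1 ∂M.pathLaw (PMF.pure s.2) := by
          refine lintegral_mono fun ω => ?_
          simp only [cumDisc_zero, ENNReal.coe_one, one_mul]
          exact mul_le_mul_left (hK _ _) _
      _ = _ := by simp
  · have hsum1 : ∑' t, ∫⁻ ω, (M.cumDisc ω (t + 1) : ℝ≥0∞) ∂M.pathLaw (PMF.pure s.2) ≠ ⊤ :=
      ne_top_of_le_ne_top (hC.tsum_cumDisc_ne_top s.2)
        (ENNReal.tsum_comp_le_tsum_of_injective (add_left_injective 1) _)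
    have hsum2 : ∑' t, ∫⁻ ω, (M.cumDisc ω (t + 1) : ℝ≥0∞)
        * ENNReal.ofReal (M.assets c s.1 ω (t + 1)) ∂M.pathLaw (PMF.pure s.2) ≠ ⊤ :=
      ne_top_of_le_ne_top (hC.tsum_assets_ne_top hcf ha.le s.2)
        (ENNReal.tsum_comp_le_tsum_of_injective (add_left_injective 1) (fun t =>
          ∫⁻ ω, (M.cumDisc ω t : ℝ≥0∞)
            * ENNReal.ofReal (M.assets c s.1 ω t) ∂M.pathLaw (PMF.pure s.2)))
    refine ne_top_of_le_ne_top (ENNReal.add_ne_top.2 ⟨ENNReal.mul_ne_top hC.ne_top hsum1,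
      ENNReal.mul_ne_top (a := m) (by simp [m]) hsum2⟩) ?_
    rw [← ENNReal.tsum_mul_left, ← ENNReal.tsum_mul_left, ← ENNReal.tsum_add]
    refine ENNReal.tsum_le_tsum fun t => ?_
    refine le_trans ?_ (add_le_add (lintegral_cumDisc_inc_le (g := fun y => M.margExt y)
      (by fun_prop) hC.inc_le (PMF.pure s.2) t) le_rfl)
    have hm := hcf.measurable_assets (M := M) s.1 (t + 1)
    rw [← lintegral_const_mul _ (by fun_prop), ← lintegral_add_right _ (by fun_prop)]
    refine lintegral_mono fun ω => ?_
    dsimp only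
    set a := M.assets c s.1 ω (t + 1) with ha'
    calc (M.cumDisc ω (t + 1) : ℝ≥0∞) * (M.margAt c a (ω (t + 1)).1 * ENNReal.ofReal a)
        ≤ (M.cumDisc ω (t + 1) : ℝ≥0∞) * ((M.margExt a + K) * ENNReal.ofReal a) :=
          mul_le_mul_right (mul_le_mul_left (hK _ _) _) _
      _ = (M.cumDisc ω (t + 1) : ℝ≥0∞) *
          (M.margExt a * ENNReal.ofReal a + K * ENNReal.ofReal a) := by
          rw [add_mul]
      _ ≤ (M.cumDisc ω (t + 1) : ℝ≥0∞) * (M.margExt (M.inc (ω (t + 1)))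
          + ENNReal.ofReal (M.marg 1) * ENNReal.ofReal a + K * ENNReal.ofReal a) := by
          refine mul_le_mul_right (add_le_add ((M.margExt_mul_le a).trans
            (add_le_add (M.antitone_margExt (hcf.inc_le_assets ha.le ω t)) le_rfl)) le_rfl) _
      _ = _ := by simp only [m]; ring

/-- Along a candidate policy `-u(c_t)` is at most a constant plus `u'(a_t)`, and `u'(a_t) ≤ u'(Y_t)`
from period one on. -/
theorem Candidate.negValue_ne_top {C : ℝ≥0∞} (hC : M.Stable C) (c : M.Candidate) (s : State Z) :
    M.negValue c s ≠ ⊤ := by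
  obtain ⟨K, hK⟩ := c.2.exists_margAt_le
  have hcf := c.2.isFeasible
  have ha : (0 : ℝ) < s.1 := s.1.2
  set k := ENNReal.ofReal |(M.u 1).toReal| + K with hk
  have hktop : k ≠ ⊤ := by simp [hk]
  have hb : ∀ ω t, 0 < M.assets c s.1 ω t → (-M.u (M.consumption c s.1 ω t)).toENNReal
      ≤ k + M.margExt (M.assets c s.1 ω t) := fun ω t hpos => by
    have h1 : 0 < M.consumption c s.1 ω t := by
      rw [consumption, extendPolicy_of_pos _ hpos]; exact c.2.pos _
    calc _ ≤ _ := M.toENNReal_neg_u_le h1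
      _ ≤ ENNReal.ofReal |(M.u 1).toReal| + (M.margExt (M.assets c s.1 ω t) + K) :=
        add_le_add le_rfl (hK _ _)
      _ = _ := by rw [hk]; ring
  rw [hcf.negValue_eq, tsum_eq_zero_add' ENNReal.summable]
  refine ENNReal.add_ne_top.2 ⟨?_, ?_⟩
  · refine ne_top_of_le_ne_top (b := k + M.margExt s.1) (ENNReal.add_ne_top.2 ⟨hktop,
      (M.margExt_lt_top_iff.2 ha).ne⟩) ?_
    calc _ ≤ ∫⁻ _, k + M.margExt s.1 ∂M.pathLaw (PMF.pure s.2) := by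
          refine lintegral_mono fun ω => ?_
          simp only [cumDisc_zero, ENNReal.coe_one, one_mul]
          exact hb ω 0 ha
      _ = _ := by simp
  · have hsum1 : ∑' t, ∫⁻ ω, (M.cumDisc ω (t + 1) : ℝ≥0∞) ∂M.pathLaw (PMF.pure s.2) ≠ ⊤ :=
      ne_top_of_le_ne_top (hC.tsum_cumDisc_ne_top s.2)
        (ENNReal.tsum_comp_le_tsum_of_injective (add_left_injective 1) _)
    refine ne_top_of_le_ne_top (ENNReal.add_ne_top.2 ⟨ENNReal.mul_ne_top hC.ne_top hsum1,
      ENNReal.mul_ne_top hktop hsum1⟩) ?_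
    rw [← ENNReal.tsum_mul_left, ← ENNReal.tsum_mul_left, ← ENNReal.tsum_add]
    refine ENNReal.tsum_le_tsum fun t => ?_
    refine le_trans ?_ (add_le_add (lintegral_cumDisc_inc_le (g := fun y => M.margExt y)
      (by fun_prop) hC.inc_le (PMF.pure s.2) t) le_rfl)
    rw [← lintegral_const_mul _ (by fun_prop), ← lintegral_add_right _ (by fun_prop)]
    refine lintegral_mono_ae ?_
    filter_upwards [hcf.ae_assets_pos hC.toBoundedMarg ha (PMF.pure s.2)] with ω hω
    calc _ ≤ (M.cumDisc ω (t + 1) : ℝ≥0∞) * (k + M.margExt (M.inc (ω (t + 1)))) :=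
          mul_le_mul_right ((hb ω (t + 1) (hω _)).trans
            (add_le_add le_rfl (M.antitone_margExt (hcf.inc_le_assets ha.le ω t)))) _
      _ = _ := by ring

/-- Comparison of a fixed point of the Euler equation with an arbitrary feasible policy; `δ` is a
gain in the initial period. -/
theorem Candidate.value_le {C : ℝ≥0∞} (hC : M.Stable C) {c : M.Candidate}
    (hfix : ∀ s, M.SolvesEuler c s (c s)) {d : State Z → ℝ} (hd : IsFeasible d) (s : State Z)
    {δ : ℝ≥0∞} (hδ : (M.u (d s)).toENNReal + (-M.u (c s)).toENNReal
        + M.margExt (c s) * ENNReal.ofReal (c s) + δ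
      ≤ (M.u (c s)).toENNReal + (-M.u (d s)).toENNReal + M.margExt (c s) * ENNReal.ofReal (d s)) :
    M.posValue d s + M.negValue c s + δ ≤ M.posValue c s + M.negValue d s := by
  have hcf := c.2.isFeasible
  obtain ⟨⟨a, ha⟩, z⟩ := s
  have ha : 0 < a := ha
  set μ := M.pathLaw (PMF.pure z) with hμ
  have hmarg : ∀ t, Measurable fun ω : ℕ → Shock Z E F H =>
      M.margAt c (M.assets c a ω t) (ω t).1 := fun t =>
    (measurable_margAt c.2.measurable).comp ((hcf.measurable_assets a t).prodMk (by fun_prop))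
  have hsplit : ∀ {e : State Z → ℝ}, IsFeasible e → ∀ t,
      ∫⁻ ω, (M.cumDisc ω t : ℝ≥0∞) * (M.margAt c (M.assets c a ω t) (ω t).1
        * ENNReal.ofReal (M.consumption e a ω t)) ∂μ
      + ∫⁻ ω, (M.cumDisc ω t : ℝ≥0∞) * (M.margAt c (M.assets c a ω t) (ω t).1
        * ENNReal.ofReal (M.assets e a ω t - M.consumption e a ω t)) ∂μ
      = ∫⁻ ω, (M.cumDisc ω t : ℝ≥0∞) * (M.margAt c (M.assets c a ω t) (ω t).1
        * ENNReal.ofReal (M.assets e a ω t)) ∂μ := fun {e} he t => by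
    have h1 := hmarg t
    have h2 := he.measurable_consumption (M := M) a t
    rw [← lintegral_add_left (by fun_prop)]
    refine lintegral_congr fun ω => ?_
    rw [← mul_add, ← mul_add, ← ENNReal.ofReal_add (he.consumption_nonneg _ ω t)
      (sub_nonneg.2 (he.consumption_le ha.le ω t)), add_sub_cancel]
  have hmu : ∀ {e : State Z → ℝ}, IsFeasible e → ∀ t, Measurable fun ω : ℕ → Shock Z E F H =>
      (M.u (M.consumption e a ω t)).toENNReal := fun he t =>
    M.measurable_toENNReal_u (he.measurable_consumption a t) fun ω => he.consumption_nonneg _ ω t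
  have hmnu : ∀ {e : State Z → ℝ}, IsFeasible e → ∀ t, Measurable fun ω : ℕ → Shock Z E F H =>
      (-M.u (M.consumption e a ω t)).toENNReal := fun he t =>
    M.measurable_toENNReal_neg_u (he.measurable_consumption a t)
      fun ω => he.consumption_nonneg _ ω t
  have hfin := Candidate.weighted_assets hC c (⟨a, ha⟩, z)
  rw [hd.posValue_eq, hcf.posValue_eq, hd.negValue_eq, hcf.negValue_eq]
  -- `C` and `C'` are the priced consumption of `d` and of `c`; priced savings and assets follow
  -- through `hsplit`. Summability of the priced assets of `c` supplies both finiteness and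
  -- transversality.
  refine ENNReal.tsum_add_le_of_telescope
    (C := fun t => ∫⁻ ω, (M.cumDisc ω t : ℝ≥0∞) * (M.margAt c (M.assets c a ω t) (ω t).1
        * ENNReal.ofReal (M.consumption d a ω t)) ∂μ)
    (C' := fun t => ∫⁻ ω, (M.cumDisc ω t : ℝ≥0∞) * (M.margAt c (M.assets c a ω t) (ω t).1
        * ENNReal.ofReal (M.consumption c a ω t)) ∂μ)
    ?_ (fun t => ?_) (hsplit hd) (hsplit hcf) rfl
    (fun t => Candidate.lintegral_euler_le hfix hC.toBoundedMarg hd ha _ t)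
    (fun t => ENNReal.ne_top_of_tsum_ne_top hfin t) (ENNReal.tendsto_atTop_zero_of_tsum_ne_top hfin)
  · have h1 := hmarg 0
    have h2 := hmu hd 0
    have h3 := hmnu hcf 0
    have h4 := hmu hcf 0
    have h5 := hmnu hd 0
    have h6 := hcf.measurable_consumption (M := M) a 0
    have h7 := hd.measurable_consumption (M := M) a 0
    have h8 : δ = ∫⁻ _, δ ∂μ := by simp [hμ]
    rw [h8]
    dsimp only
    rw [← lintegral_add_left (by fun_prop), ← lintegral_add_left (by fun_prop),
      ← lintegral_add_left (by fun_prop), ← lintegral_add_left (by fun_prop),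
      ← lintegral_add_left (by fun_prop)]
    refine lintegral_mono_ae ?_
    filter_upwards [ae_pathLaw_pure_fst z] with ω hω
    simp only [cumDisc_zero, ENNReal.coe_one, one_mul, consumption, assets, margAt, hω,
      extendPolicy_of_pos _ ha]
    exact hδ
  · have h1 := hmarg t
    have h2 := hmu hd t
    have h3 := hmnu hcf t
    have h4 := hmu hcf t
    have h5 := hmnu hd t
    have h6 := hcf.measurable_consumption (M := M) a t
    have h7 := hd.measurable_consumption (M := M) a t
    dsimp only
    rw [← lintegral_add_left (by fun_prop), ← lintegral_add_left (by fun_prop),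
      ← lintegral_add_left (by fun_prop), ← lintegral_add_left (by fun_prop)]
    refine lintegral_mono_ae ?_
    filter_upwards [hcf.ae_assets_pos hC.toBoundedMarg ha (PMF.pure z)] with ω hω
    rw [← mul_add, ← mul_add, ← mul_add, ← mul_add]
    refine mul_le_mul_right ?_ _
    refine M.toENNReal_u_tangent ?_ (hd.consumption_nonneg _ ω t)
    rw [consumption, extendPolicy_of_pos _ (hω t)]
    exact c.2.pos _

theorem lifetimeValue_le_of_add_le {c d : State Z → ℝ} {s : State Z}
    (hd : M.posValue d s ≠ ⊤) (hc : M.posValue c s ≠ ⊤) (hnc : M.negValue c s ≠ ⊤)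
    (h : M.posValue d s + M.negValue c s ≤ M.posValue c s + M.negValue d s) :
    M.lifetimeValue d s ≤ M.lifetimeValue c s := by
  rw [lifetimeValue_eq, lifetimeValue_eq]
  rcases eq_or_ne (M.negValue d s) ⊤ with hnd | hnd
  · simp [hnd]
  lift M.posValue d s to ℝ≥0 using hd with pd
  lift M.posValue c s to ℝ≥0 using hc with pc
  lift M.negValue c s to ℝ≥0 using hnc with nc
  lift M.negValue d s to ℝ≥0 using hnd with nd
  simp only [EReal.coe_nnreal_eq_coe_real, ← EReal.coe_sub, EReal.coe_le_coe_iff]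
  have h' : (pd : ℝ) + nc ≤ pc + nd := by exact_mod_cast h
  linarith

theorem lifetimeValue_lt_of_add_le {c d : State Z → ℝ} {s : State Z} {δ : ℝ≥0∞} (hδ : δ ≠ 0)
    (hd : M.posValue d s ≠ ⊤) (hc : M.posValue c s ≠ ⊤) (hnc : M.negValue c s ≠ ⊤)
    (hnd : M.negValue d s ≠ ⊤)
    (h : M.posValue d s + M.negValue c s + δ ≤ M.posValue c s + M.negValue d s) :
    M.lifetimeValue d s < M.lifetimeValue c s := by
  rw [lifetimeValue_eq, lifetimeValue_eq]
  have h1 : M.posValue d s + M.negValue c s < M.posValue c s + M.negValue d s :=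
    (ENNReal.lt_add_right (ENNReal.add_ne_top.2 ⟨hd, hnc⟩) hδ).trans_le h
  lift M.posValue d s to ℝ≥0 using hd with pd
  lift M.posValue c s to ℝ≥0 using hc with pc
  lift M.negValue c s to ℝ≥0 using hnc with nc
  lift M.negValue d s to ℝ≥0 using hnd with nd
  simp only [EReal.coe_nnreal_eq_coe_real, ← EReal.coe_sub, EReal.coe_lt_coe_iff]
  have h' : (pd : ℝ) + nc < pc + nd := by exact_mod_cast h1
  linarith

/-- If `d` differs from `c` at `s`, start there: consumption differs already in period zero, almost
surely, so strict concavity yields a fixed gain `δ` and no argument about later visits is needed.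
The strict comparison also uses that candidates have finite value. -/
theorem Stable.isOptimal_iff {C : ℝ≥0∞} (hC : M.Stable C) {c : M.Candidate}
    (hfix : ∀ s, M.SolvesEuler c s (c s)) (d : M.Candidate) : M.IsOptimal d ↔ d = c := by
  have hcf := c.2.isFeasible
  constructor
  · intro hd
    refine Subtype.ext (funext fun s => ?_)
    by_contra hne
    obtain ⟨δ, hδ0, hδ⟩ := M.exists_toENNReal_u_tangent (c.2.pos s) (d.2.pos s) hne
    have h := lifetimeValue_lt_of_add_le hδ0 (hC.posValue_ne_top hd.1 s)
      (hC.posValue_ne_top hcf s) (Candidate.negValue_ne_top hC c s)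
      (Candidate.negValue_ne_top hC d s) (Candidate.value_le hC hfix hd.1 s hδ)
    exact absurd (hd.2 c hcf s) h.not_ge
  · rintro rfl
    refine ⟨hcf, fun e he s => ?_⟩
    have h := Candidate.value_le hC hfix he s (δ := 0) (by
      rw [add_zero]
      exact M.toENNReal_u_tangent (d.2.pos s) (he.2 s).1)
    rw [add_zero] at h
    exact lifetimeValue_le_of_add_le (hC.posValue_ne_top he s) (hC.posValue_ne_top hcf s)
      (Candidate.negValue_ne_top hC d s) h

theorem IsStationary.exists_stable {π : PMF Z} (hπ : M.IsStationary π)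
    (hβ : ∫⁻ ω, (M.disc (ω 1) : ℝ≥0∞) ∂M.pathLaw π < ⊤)
    (hβR : ∫⁻ ω, ((M.disc (ω 1) * M.ret (ω 1) : ℝ≥0) : ℝ≥0∞) ∂M.pathLaw π < ⊤)
    (hGβ : M.growthRate π M.disc < 1)
    (hGβR : M.growthRate π (fun x => M.disc x * M.ret x) < 1)
    (hY : ∫⁻ ω, (M.inc (ω 1) : ℝ≥0∞) ∂M.pathLaw π < ⊤)
    (huY : ∫⁻ ω, M.margExt (M.inc (ω 1)) ∂M.pathLaw π < ⊤) : ∃ C, M.Stable C := by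
  obtain ⟨C₁, hC₁, h₁⟩ := hπ.exists_bound_inc (g := fun y => (y : ℝ≥0∞)) (by fun_prop) hY
  obtain ⟨C₂, hC₂, h₂⟩ := hπ.exists_bound_inc (g := fun y => M.margExt y) (by fun_prop) huY
  have h3 := hπ.tsum_op_ne_top (φ := fun x => M.disc x * M.ret x) (by fun_prop) hβR hGβR
  exact ⟨max C₁ C₂, ⟨(max_lt hC₁.lt_top hC₂.lt_top).ne,
    fun z => ENNReal.ne_top_of_tsum_ne_top (h3 z) 1, fun z => (h₂ z).trans (le_max_right _ _)⟩,
    fun z => (h₁ z).trans (le_max_left _ _), hπ.tsum_op_ne_top (by fun_prop) hβ hGβ, h3⟩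

/-- Iterates of the transition operator with weight `βR` tend to zero, uniformly over the states. -/
theorem Stable.eventually_op_iterate_le {C : ℝ≥0∞} (hC : M.Stable C) {q : ℝ≥0} (hq : 0 < q) :
    ∀ᶠ n in atTop, ∀ z, (M.op fun x => M.disc x * M.ret x)^[n] 1 z ≤ q := by
  rw [eventually_all]
  exact fun z => ((ENNReal.tendsto_atTop_zero_of_tsum_ne_top
    (hC.tsum_disc_ret_ne_top z)).eventually_lt_const (by exact_mod_cast hq)).mono fun n h => h.le

end Optimality

end IncomeFluctuation

end

/-! ### The main theorem. -/

theorem mainTheorem1 {Z E F H : Type*} [Finite Z] [MeasurableSpace Z] [DiscreteMeasurableSpace Z]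
    [MeasurableSpace E] [MeasurableSpace F] [MeasurableSpace H]
    (M : IncomeFluctuation Z E F H) (π : PMF Z) (hπ : M.IsStationary π)
    (hβ : ∫⁻ ω, (M.disc (ω 1) : ℝ≥0∞) ∂M.pathLaw π < ⊤)
    (hβR : ∫⁻ ω, ((M.disc (ω 1) * M.ret (ω 1) : ℝ≥0) : ℝ≥0∞) ∂M.pathLaw π < ⊤)
    (hGβ : M.growthRate π M.disc < 1)
    (hGβR : M.growthRate π (fun x => M.disc x * M.ret x) < 1)
    (hY : ∫⁻ ω, (M.inc (ω 1) : ℝ≥0∞) ∂M.pathLaw π < ⊤)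
    (huY : ∫⁻ ω, M.margExt (M.inc (ω 1)) ∂M.pathLaw π < ⊤) :
    ∃ T : M.Candidate → M.Candidate, M.IsTimeIteration T ∧
      (∃ n : ℕ, 1 ≤ n ∧ ∃ θ : ℝ≥0, ContractingWith θ (T^[n])) ∧
      ∃ cStar : M.Candidate,
        (∀ c : M.Candidate, T c = c ↔ c = cStar) ∧
        (∀ c : M.Candidate, M.IsOptimal c ↔ c = cStar) ∧
        ∀ c : M.Candidate, Tendsto (fun k : ℕ => dist (T^[k] c) cStar) atTop (𝓝 0) := by
  obtain ⟨C, hC⟩ := hπ.exists_stable hβ hβR hGβ hGβR hY huY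
  obtain ⟨T, hT⟩ := IncomeFluctuation.exists_timeIteration hC.toBoundedMarg
  obtain ⟨n, hn, hn1⟩ := ((hC.eventually_op_iterate_le (q := 1 / 2) (by norm_num)).and
    (eventually_ge_atTop 1)).exists
  have hcontr : ContractingWith (1 / 2) (T^[n]) :=
    ⟨by rw [← NNReal.coe_lt_coe]; norm_num, LipschitzWith.of_dist_le_mul (hT.dist_iterate_le hn)⟩
  set c₀ := ContractingWith.fixedPoint (T^[n]) hcontr
  have hc₀ : T c₀ = c₀ := hcontr.isFixedPt_fixedPoint_iterate
  -- The Lipschitz constants of `T^[k]` themselves tend to zero, so `k` need not be split modulo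
  -- `n`.
  have hlim : ∀ c : M.Candidate, Tendsto (fun k : ℕ => dist (T^[k] c) c₀) atTop (𝓝 0) := by
    intro c
    rw [Metric.tendsto_atTop]
    intro ε hε
    obtain ⟨q, hq0, hq⟩ : ∃ q : ℝ≥0, 0 < q ∧ q * dist c c₀ < ε := by
      refine ⟨(ε / (dist c c₀ + 1)).toNNReal, by simp; positivity, ?_⟩
      rw [Real.coe_toNNReal _ (by positivity), div_mul_eq_mul_div, div_lt_iff₀ (by positivity)]
      nlinarith [dist_nonneg (x := c) (y := c₀)]
    obtain ⟨N, hN⟩ := eventually_atTop.1 (hC.eventually_op_iterate_le hq0)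
    refine ⟨N, fun k hk => ?_⟩
    have h := hT.dist_iterate_le (hN k hk) c c₀
    rw [Function.iterate_fixed hc₀] at h
    rw [Real.dist_eq, sub_zero, abs_of_nonneg dist_nonneg]
    exact h.trans_lt hq
  refine ⟨T, hT, ⟨n, hn1, 1 / 2, hcontr⟩, c₀, fun c => ⟨fun h => ?_, ?_⟩, fun c => ?_, hlim⟩
  · exact hcontr.fixedPoint_unique (Function.iterate_fixed h n)
  · rintro rfl
    exact hc₀
  · refine hC.isOptimal_iff (fun s => ?_) c
    have h := hT.solvesEuler c₀ s
    rwa [hc₀] at h
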